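/- **Setting.** Let $m,\nu,r,k,s$ be non-negative integers with $\nu<s$ and $r,k\ge s$. Let $\Omega\subseteq\mathbb R^{2m}$ be open (for instance $\Omega=\mathbb R^{2m}$), let $H:\Omega\to\mathbb R$ and $L=(L_1,\dots,L_\nu):\Omega\to\mathbb R^\nu$ be of class $C^\infty$, let $J=\begin{pmatrix}0&I_m\\-I_m&0\end{pmatrix}$, and suppose that $L_1,\dots,L_\nu$ are invariants of $y'=J\nabla H(y)$, i.e. $\nabla L_i(x)^TJ\nabla H(x)=0$ for all $x\in\Omega$ and all $i$. Let $y:[0,T]\to\Omega$, $T>0$, be the solution of $y'=J\nabla H(y)$, $y(0)=y_0$. Let $P_0,P_1,\dots$ be the Legendre polynomials shifted and scaled to be orthonormal on $[0,1]$, let $c_1<\dots<c_k$ and $\hat c_1<\dots<\hat c_r$ in $(0,1)$ be the zeros of $P_k$ and $P_r$ (Gauss–Legendre abscissae), and let $b_\ell$, $\hat b_\ell$ be the corresponding quadrature weights. **Method.** One step of length $h>0$ of the ELIM$(r,k,s)$ method computes a polynomial $u$ on $[0,h]$ and scalars $\hat\alpha_{s-\nu},\dots,\hat\alpha_{s-1}$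 such that, with $$\hat\gamma_j=\sum_{\ell=1}^k b_\ell P_j(c_\ell)J\nabla H(u(c_\ell h)),\qquad \hat\phi_j=\sum_{\ell=1}^r\hat b_\ell P_j(\hat c_\ell)\nabla L(u(\hat c_\ell h))\in\mathbb R^{2m\times\nu},$$ $\hat\eta_j=1$ for $0\le j<s-\nu$ and $\hat\eta_j=1-h^{2(s-1-j)}\hat\alpha_j$ for $s-\nu\le j\le s-1$, one has $$u(xh)=y_0+h\sum_{j=0}^{s-1}\int_0^xP_j(t)\,dt\;\hat\eta_j\hat\gamma_j\quad(0\le x\le1),\qquad \sum_{j=s-\nu}^{s-1}h^{2(s-1-j)}\hat\alpha_j\,\hat\phi_j^T\hat\gamma_j=\sum_{j=0}^{s-1}\hat\phi_j^T\hat\gamma_j .$$ The new approximation is $y_1=u(h)$. **Nonsingularity assumption.** For a curve $\sigma$ put $\phi_j(\sigma)=\int_0^1P_j(\tau)\nabla L(\sigma(\tau h))\,d\tau$, $\bar\gamma_j(\sigma)=\int_0^1P_j(\tau)J\nabla H(\sigma(\tau h))\,d\tau$, and let $\Gamma_h(\sigma)$ be the $\nu\times\nu$ matrix with columns $h^{2(s-1-j)}\phi_j(\sigma)^T\bar\gamma_j(\sigma)$,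 $j=s-\nu,\dots,s-1$, whose entries are $O(h^{2s-2})$ for smooth $\sigma$. Assume that $\Gamma_h$ is nonsingular at this scale as $h\to0^+$: there is $\kappa>0$ with $|\det(h^{-(2s-2)}\Gamma_h(y))|\ge\kappa$ for all sufficiently small $h>0$. **Theorem.** Under these assumptions, suppose that for all sufficiently small $h>0$ the pair $(u_h,\hat\alpha_h)$ satisfies the equations of one ELIM$(r,k,s)$ step from $y_0$, and that as $h\to0^+$ the polynomials $u_h$ stay on $[0,h]$ in a fixed compact subset of $\Omega$ and the vectors $\hat\alpha_h$ stay bounded. Then $y_1=u_h(h)$ satisfies $$y_1-y(h)=O(h^{2s+1})\qquad(h\to0^+),$$ that is, the method has order $2s$. -/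

import Mathlib

open Set Filter Topology Asymptotics
open scoped ContDiff

namespace ELIM

noncomputable section

/-- The phase space `ℝ^{2m}`; the left summand indexes the positions `q`, the right one the
momenta `p`. -/
abbrev Phase (m : ℕ) : Type := EuclideanSpace ℝ (Fin m ⊕ Fin m)

/-- The matrix `J = [[0, I], [-I, 0]]`. -/
def J (m : ℕ) : Matrix (Fin m ⊕ Fin m) (Fin m ⊕ Fin m) ℝ :=
  Matrix.fromBlocks 0 1 (-1) 0

/-- The Hamiltonian vector field `x ↦ J ∇H(x)`. -/
def hamField {m : ℕ} (H : Phase m → ℝ) (x : Phase m) : Phase m :=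
  Matrix.toEuclideanCLM (𝕜 := ℝ) (J m) (gradient H x)

/-- The Legendre polynomial of degree `j`, shifted and scaled to be orthonormal on `[0,1]`. (The
polynomials of Mathlib have `L²` norm `1 / √(2j+1)` on `[0,1]` and leading coefficient of sign
`(-1)^j`.) -/
def legendre (j : ℕ) : Polynomial ℝ :=
  Polynomial.C (Real.sqrt (2 * j + 1) * (-1) ^ j) *
    (Polynomial.shiftedLegendre j).map (Int.castRingHom ℝ)

/-- `c` lists, in increasing order, the `k` Gauss-Legendre abscissae on `[0,1]`, and `b` the
corresponding (interpolatory) quadrature weights. -/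
structure IsGaussLegendre (k : ℕ) (c b : Fin k → ℝ) : Prop where
  strictMono : StrictMono c
  mem_Ioo : ∀ i, c i ∈ Ioo (0 : ℝ) 1
  root : ∀ i, (legendre k).eval (c i) = 0
  weight : ∀ i, b i = ∫ x in (0 : ℝ)..1, (Lagrange.basis Finset.univ c i).eval x

section Continuous

/-- `φ_j(σ)`, whose `i`-th column is `∫₀¹ P_j(τ) ∇L_i(σ(τh)) dτ`. -/
def phi {m ν : ℕ} (L : Phase m → EuclideanSpace ℝ (Fin ν)) (h : ℝ) (σ : ℝ → Phase m)
    (j : ℕ) (i : Fin ν) : Phase m :=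
  ∫ τ in (0 : ℝ)..1, (legendre j).eval τ • gradient (fun x => L x i) (σ (τ * h))

/-- `γ̄_j(σ) = ∫₀¹ P_j(τ) J∇H(σ(τh)) dτ`. -/
def gammaBar {m : ℕ} (H : Phase m → ℝ) (h : ℝ) (σ : ℝ → Phase m) (j : ℕ) : Phase m :=
  ∫ τ in (0 : ℝ)..1, (legendre j).eval τ • hamField H (σ (τ * h))

/-- The `ν × ν` matrix `Γ(σ)`. Its columns correspond to `j = s-ν, …, s-1`: the column of
`j = s-ν+l` is `h^{2(s-1-j)} φ_j(σ)ᵀ γ̄_j(σ)`, with `s-1-j = ν-1-l`. -/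
def Gamma {m ν : ℕ} (H : Phase m → ℝ) (L : Phase m → EuclideanSpace ℝ (Fin ν)) (s : ℕ) (h : ℝ)
    (σ : ℝ → Phase m) : Matrix (Fin ν) (Fin ν) ℝ :=
  Matrix.of fun i l =>
    h ^ (2 * (ν - 1 - (l : ℕ))) *
      inner ℝ (phi L h σ (s - ν + l) i) (gammaBar H h σ (s - ν + l))

/-- Nonsingularity of `Γ(σ)` at its natural scale as `h → 0⁺`. The entries of the `ν × ν` matrix
`Γ(σ)` are `O(h^{2s-2})`; the matrices `h^{-(2s-2)} Γ(σ)` are required to have determinants bounded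
away from zero. -/
def GammaNonsingular {m ν : ℕ} (H : Phase m → ℝ) (L : Phase m → EuclideanSpace ℝ (Fin ν)) (s : ℕ)
    (σ : ℝ → Phase m) : Prop :=
  ∃ κ : ℝ, 0 < κ ∧
    ∀ᶠ h in 𝓝[>] (0 : ℝ), κ * (h ^ (2 * (s - 1))) ^ ν ≤ |(Gamma H L s h σ).det|

end Continuous

section Discrete

/-- `φ̂_j`, whose `i`-th column is `∑_ℓ b̂_ℓ P_j(ĉ_ℓ) ∇L_i(u(ĉ_ℓ h))`. -/
def phiHat {m ν r : ℕ} (L : Phase m → EuclideanSpace ℝ (Fin ν)) (c' b' : Fin r → ℝ) (h : ℝ)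
    (u : ℝ → Phase m) (j : ℕ) (i : Fin ν) : Phase m :=
  ∑ l, (b' l * (legendre j).eval (c' l)) • gradient (fun x => L x i) (u (c' l * h))

/-- `γ̂_j = ∑_ℓ b_ℓ P_j(c_ℓ) J∇H(u(c_ℓ h))`. -/
def gammaHat {m k : ℕ} (H : Phase m → ℝ) (c b : Fin k → ℝ) (h : ℝ)
    (u : ℝ → Phase m) (j : ℕ) : Phase m :=
  ∑ l, (b l * (legendre j).eval (c l)) • hamField H (u (c l * h))

/-- The coefficients `η̂_j`: equal to `1` for `j < s-ν` and to `1 - h^{2(s-1-j)} α̂_j` for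
`s-ν ≤ j ≤ s-1`. The entry `α l` is the scalar `α̂_j` with `j = s-ν+l`. -/
def etaHat {ν : ℕ} (s : ℕ) (h : ℝ) (α : Fin ν → ℝ) (j : ℕ) : ℝ :=
  if hj : s - ν ≤ j ∧ j - (s - ν) < ν then
    1 - h ^ (2 * (s - 1 - j)) * α ⟨j - (s - ν), hj.2⟩
  else 1

/-- The equations of one step of size `h` of the ELIM(r,k,s) method from `y₀`, with quadratures
`(c, b)` (`k` nodes, used for `J∇H`) and `(c', b')` (`r` nodes, used for `∇L`), for the polynomial
`u` on `[0,h]` and the vector `α` of scalars `α̂_{s-ν}, …, α̂_{s-1}`. The new approximation is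
`y₁ = u h`. -/
structure IsStep {m ν r k : ℕ} (H : Phase m → ℝ) (L : Phase m → EuclideanSpace ℝ (Fin ν)) (s : ℕ)
    (c b : Fin k → ℝ) (c' b' : Fin r → ℝ) (y₀ : Phase m) (h : ℝ)
    (u : ℝ → Phase m) (α : Fin ν → ℝ) : Prop where
  poly : ∀ x ∈ Icc (0 : ℝ) 1,
    u (x * h) = y₀ + h • ∑ j ∈ Finset.range s,
      (∫ t in (0 : ℝ)..x, (legendre j).eval t) • (etaHat s h α j • gammaHat H c b h u j)
  invariants : ∀ i : Fin ν,
    ∑ l : Fin ν, h ^ (2 * (ν - 1 - (l : ℕ))) * α l *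
        inner ℝ (phiHat L c' b' h u (s - ν + l) i) (gammaHat H c b h u (s - ν + l)) =
      ∑ j ∈ Finset.range s, inner ℝ (phiHat L c' b' h u j i) (gammaHat H c b h u j)

end Discrete

end

end ELIM

/-! Rescale time to `[0,1]` and let `V h x = u_h (x h)`. The `n`-th derivative of `V h` is `O(h^n)`,
and the same holds for smooth functions of `V h` (`ScaledTo`). Such a family is, up to `O(h^n)`, a
polynomial of degree less than `n`. Hence its `j`-th Legendre coefficient is `O(h^j)`, and the Gauss
formulas compute this coefficient up to `O(h^(2s-j))`.

The key point is that the `α̂`, assumed only bounded, are in fact `O(h^2)`. Since `∇L` is orthogonal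
to `J∇H`, the sum of the products `φ_jᵀ γ̄_j`, which integrates `∇L` against the truncated Legendre
expansion of `J∇H`, is minus the integral of `∇L` against the truncation remainder. That remainder
is orthogonal to low degrees, so the integral is a product of two remainders, `O(h^(2s))`; passing
to discrete coefficients costs no more (`sum_inner_isBigO`). With bounded `α̂`, Grönwall already
gives an error `O(h^s)` on the step (`unifO_sub`), enough for the matrix of the `α̂`-system to
differ from `Γ_h(y)` by `O(h^(2s-1))`. As its natural scale is `h^(2s-2)`, nonsingularity yields `α̂
= O(h^2)` (`isBigO_of_mulVec_of_det`).

The factor `η̂_j` then changes the `j`-th coefficient by `O(h^(2(s-1-j)+2+j)) = O(h^(2s-j))`, no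
more than quadrature does. Tested against a solution `Z` of the adjoint equation, the `j`-th defect
meets the `j`-th Legendre coefficient of `Z`, which is `O(h^j)`; so the residual contributes
`O(h^(2s))`, and the factor `h` of the rescaled equation gives `O(h^(2s+1))` (`sub_isBigO`). -/

namespace ELIM

/-! ### Legendre polynomials and exactness of Gauss-Legendre quadrature. -/

open Polynomial

/-- The linear functional `p ↦ ∫₀¹ p(x) dx` on real polynomials. -/
noncomputable def unitIntegral : ℝ[X] →ₗ[ℝ] ℝ where
  toFun p := ∫ x in (0 : ℝ)..1, p.eval x
  map_add' p q := by
    simp only [eval_add]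
    exact intervalIntegral.integral_add (p.continuous.intervalIntegrable _ _)
      (q.continuous.intervalIntegrable _ _)
  map_smul' c p := by
    simp [eval_smul]

lemma unitIntegral_apply (p : ℝ[X]) : unitIntegral p = ∫ x in (0 : ℝ)..1, p.eval x := rfl

lemma unitIntegral_derivative (p : ℝ[X]) :
    unitIntegral (derivative p) = p.eval 1 - p.eval 0 := by
  rw [unitIntegral_apply]
  exact intervalIntegral.integral_eq_sub_of_hasDerivAt (fun x _ => p.hasDerivAt x)
    ((derivative p).continuous.intervalIntegrable _ _)

lemma unitIntegral_derivative_mul {p q : ℝ[X]} (h0 : (p * q).eval 0 = 0)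
    (h1 : (p * q).eval 1 = 0) :
    unitIntegral (derivative p * q) = -unitIntegral (p * derivative q) := by
  have h := unitIntegral_derivative (p * q)
  rw [derivative_mul, map_add, h0, h1] at h
  linarith

lemma unitIntegral_iterate_derivative_mul (n : ℕ) {w : ℝ[X]}
    (h0 : ∀ i < n, (derivative^[i] w).eval 0 = 0) (h1 : ∀ i < n, (derivative^[i] w).eval 1 = 0)
    (p : ℝ[X]) :
    unitIntegral (derivative^[n] w * p) = (-1) ^ n * unitIntegral (w * derivative^[n] p) := by
  induction n generalizing p with
  | zero => simp
  | succ n ih =>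
    rw [Function.iterate_succ_apply', unitIntegral_derivative_mul,
      ih (fun i hi => h0 i (by omega)) (fun i hi => h1 i (by omega)),
      Function.iterate_succ_apply, pow_succ]
    · ring
    · rw [eval_mul, h0 n (by omega), zero_mul]
    · rw [eval_mul, h1 n (by omega), zero_mul]

/-- Euler's Beta integral, by parts; the case `a = b = n` gives the norm of the Legendre polynomial.
-/
lemma unitIntegral_X_pow_mul_one_sub_X_pow (a b : ℕ) :
    unitIntegral (X ^ a * (1 - X) ^ b) * ((a + b + 1).factorial : ℝ) =
      a.factorial * b.factorial := by
  induction b generalizing a with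
  | zero =>
    rw [unitIntegral_apply]
    simp [integral_pow, Nat.factorial_succ]
    field_simp
  | succ b ih =>
    have h := unitIntegral_derivative_mul (p := X ^ (a + 1)) (q := (1 - X) ^ (b + 1))
      (by simp) (by simp)
    have e1 : derivative (X ^ (a + 1) : ℝ[X]) * (1 - X) ^ (b + 1) =
        ((a : ℝ) + 1) • (X ^ a * (1 - X) ^ (b + 1)) := by
      rw [derivative_X_pow, smul_eq_C_mul]
      simp only [Nat.cast_add, Nat.cast_one, map_add, map_one, add_tsub_cancel_right]
      ring
    have e2 : (X ^ (a + 1) : ℝ[X]) * derivative ((1 - X) ^ (b + 1)) =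
        (-((b : ℝ) + 1)) • (X ^ (a + 1) * (1 - X) ^ b) := by
      rw [derivative_pow, smul_eq_C_mul]
      simp only [Nat.cast_add, Nat.cast_one, map_add, map_one, map_neg, add_tsub_cancel_right,
        derivative_sub, derivative_one, derivative_X]
      ring
    rw [e1, e2, map_smul, map_smul, smul_eq_mul, smul_eq_mul] at h
    have h2 := ih (a + 1)
    have ha : ((a : ℝ) + 1) ≠ 0 := by positivity
    rw [show a + 1 + b + 1 = a + (b + 1) + 1 by ring] at h2
    apply mul_left_cancel₀ ha
    rw [← mul_assoc, h]
    rw [Nat.factorial_succ a] at h2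
    rw [Nat.factorial_succ b]
    push_cast at h2 ⊢
    linear_combination ((b : ℝ) + 1) * h2

lemma factorial_smul_shiftedLegendre_map (n : ℕ) :
    (n.factorial : ℝ) • (shiftedLegendre n).map (Int.castRingHom ℝ) =
      derivative^[n] (X ^ n * (1 - X) ^ n) := by
  have h := congrArg (Polynomial.map (Int.castRingHom ℝ)) (factorial_mul_shiftedLegendre_eq n)
  rw [Polynomial.map_mul, ← iterate_derivative_map] at h
  simpa [smul_eq_C_mul] using h

/-- Rodrigues' formula followed by `n` integrations by parts; boundary terms vanish because `X^n
(1-X)^n` has zeros of order `n` at both ends. -/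
lemma unitIntegral_shiftedLegendre_mul (n : ℕ) (p : ℝ[X]) :
    n.factorial * unitIntegral ((shiftedLegendre n).map (Int.castRingHom ℝ) * p) =
      (-1) ^ n * unitIntegral (X ^ n * (1 - X) ^ n * derivative^[n] p) := by
  rw [← unitIntegral_iterate_derivative_mul, ← factorial_smul_shiftedLegendre_map,
    smul_mul_assoc, map_smul, smul_eq_mul]
  · intro i hi
    obtain ⟨q, hq⟩ := pow_sub_dvd_iterate_derivative_of_pow_dvd (p := (X ^ n * (1 - X) ^ n : ℝ[X]))
      (q := X) i (dvd_mul_right _ _)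
    rw [hq]
    simp [Nat.sub_ne_zero_of_lt hi]
  · intro i hi
    obtain ⟨q, hq⟩ := pow_sub_dvd_iterate_derivative_of_pow_dvd (p := (X ^ n * (1 - X) ^ n : ℝ[X]))
      (q := 1 - X) i (dvd_mul_left _ _)
    rw [hq]
    simp [Nat.sub_ne_zero_of_lt hi]

lemma degree_map_shiftedLegendre (n : ℕ) :
    ((shiftedLegendre n).map (Int.castRingHom ℝ)).degree = n := by
  rw [degree_map_eq_of_injective (RingHom.injective_int _), degree_shiftedLegendre]

lemma natDegree_map_shiftedLegendre (n : ℕ) :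
    ((shiftedLegendre n).map (Int.castRingHom ℝ)).natDegree = n :=
  natDegree_eq_of_degree_eq_some (degree_map_shiftedLegendre n)

lemma degree_legendre (n : ℕ) : (legendre n).degree = n := by
  rw [legendre, degree_C_mul, degree_map_shiftedLegendre]
  have : (0 : ℝ) < 2 * n + 1 := by positivity
  positivity

lemma natDegree_legendre (n : ℕ) : (legendre n).natDegree = n :=
  natDegree_eq_of_degree_eq_some (degree_legendre n)

lemma unitIntegral_legendre_mul_eq_zero {n : ℕ} {p : ℝ[X]} (hp : p.degree < n) :
    unitIntegral (legendre n * p) = 0 := by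
  have h := unitIntegral_shiftedLegendre_mul n p
  rw [iterate_derivative_eq_zero_of_degree_lt hp, mul_zero, map_zero, mul_zero] at h
  rw [legendre, mul_assoc, ← smul_eq_C_mul, map_smul,
    (mul_eq_zero.1 h).resolve_left (by positivity), smul_zero]

lemma unitIntegral_legendre_mul_self (n : ℕ) : unitIntegral (legendre n * legendre n) = 1 := by
  set S := (shiftedLegendre n).map (Int.castRingHom ℝ) with hS
  have h := unitIntegral_shiftedLegendre_mul n S
  -- Only the leading coefficient, `(-1)^n` times the central binomial coefficient, survives `n`
  -- derivatives.
  have hd : derivative^[n] S = C ((-1) ^ n * (n.factorial * ((n + n).choose n : ℝ))) := by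
    have hc : (derivative^[n] S).natDegree ≤ 0 := by
      have := natDegree_iterate_derivative S n
      rw [natDegree_map_shiftedLegendre] at this
      omega
    rw [eq_C_of_natDegree_le_zero hc, coeff_iterate_derivative, zero_add,
      Nat.descFactorial_self, hS, coeff_map, coeff_shiftedLegendre]
    simp
    ring
  rw [hd, mul_comm (X ^ n * (1 - X) ^ n) (C _), ← smul_eq_C_mul, map_smul, smul_eq_mul] at h
  have hb := unitIntegral_X_pow_mul_one_sub_X_pow n n
  have hch := Nat.add_choose_mul_factorial_mul_factorial n n
  have hch' : ((n + n).choose n : ℝ) * n.factorial * n.factorial = (n + n).factorial := by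
    exact_mod_cast hch
  rw [Nat.factorial_succ] at hb
  push_cast at hb
  have hpos : (0 : ℝ) < 2 * n + 1 := by positivity
  have hsq : ((-1 : ℝ) ^ n) * (-1) ^ n = 1 := by rw [← mul_pow]; simp
  have e : legendre n * legendre n = ((2 * n + 1 : ℝ)) • (S * S) := by
    rw [legendre, smul_eq_C_mul, ← hS]
    calc _ = C ((Real.sqrt (2 * n + 1) * (-1) ^ n) * (Real.sqrt (2 * n + 1) * (-1) ^ n)) *
        (S * S) := by rw [C_mul (a := Real.sqrt (2 * n + 1) * (-1) ^ n)]; ring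
      _ = _ := by
        rw [show (Real.sqrt (2 * n + 1) * (-1) ^ n) * (Real.sqrt (2 * n + 1) * (-1) ^ n) =
          (Real.sqrt (2 * n + 1) * Real.sqrt (2 * n + 1)) * ((-1) ^ n * (-1) ^ n) by ring, hsq,
          Real.mul_self_sqrt hpos.le, mul_one]
  rw [e, map_smul, smul_eq_mul]
  have hf : (n.factorial : ℝ) ≠ 0 := by positivity
  have hf2 : ((n + n).factorial : ℝ) ≠ 0 := by positivity
  set I := unitIntegral (S * S)
  set B := unitIntegral (X ^ n * (1 - X) ^ n)
  have h3 : I = ((n + n).choose n : ℝ) * B := by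
    apply mul_left_cancel₀ hf
    rw [h]
    linear_combination (n.factorial * ((n + n).choose n : ℝ)) * B * hsq
  rw [h3]
  apply mul_right_cancel₀ hf2
  linear_combination ((n + n).choose n : ℝ) * hb + hch'

lemma unitIntegral_legendre_mul_legendre (i j : ℕ) :
    unitIntegral (legendre i * legendre j) = if i = j then 1 else 0 := by
  split_ifs with h
  · rw [h, unitIntegral_legendre_mul_self]
  · rcases Nat.lt_or_gt_of_ne h with h | h
    · rw [mul_comm]
      exact unitIntegral_legendre_mul_eq_zero (by rw [degree_legendre]; exact_mod_cast h)
    · exact unitIntegral_legendre_mul_eq_zero (by rw [degree_legendre]; exact_mod_cast h)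

/-- A polynomial of degree less than `s` is its own truncated Legendre expansion. -/
lemma sum_legendre_expansion {s : ℕ} {p : ℝ[X]} (hp : p.degree < s) :
    ∑ j ∈ Finset.range s, unitIntegral (legendre j * p) • legendre j = p := by
  induction s generalizing p with
  | zero =>
    have : p = 0 := by simpa using hp
    simp [this]
  | succ s ih =>
    set c := p.coeff s / (legendre s).coeff s with hc
    have hl : (legendre s).coeff s ≠ 0 := by
      have := leadingCoeff_ne_zero.2 (ne_zero_of_degree_gt
        (n := ⊥) (by rw [degree_legendre]; exact WithBot.bot_lt_coe s : ⊥ < (legendre s).degree))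
      rwa [leadingCoeff, natDegree_legendre] at this
    set q := p - c • legendre s with hq
    have hqd : q.degree < s := by
      rw [degree_lt_iff_coeff_zero]
      intro m hm
      rcases hm.eq_or_lt with rfl | hm
      · rw [hq, coeff_sub, coeff_smul, smul_eq_mul, hc, div_mul_cancel₀ _ hl, sub_self]
      · rw [hq, coeff_sub, coeff_smul,
          (degree_lt_iff_coeff_zero p (s + 1)).1 hp m hm,
          coeff_eq_zero_of_natDegree_lt (by rwa [natDegree_legendre]), smul_zero, sub_zero]
    have hpq : p = q + c • legendre s := by rw [hq]; ring
    have h1 := ih hqd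
    have h2 : unitIntegral (legendre s * p) = c := by
      rw [hpq, mul_add, map_add, unitIntegral_legendre_mul_eq_zero hqd, mul_smul_comm, map_smul,
        unitIntegral_legendre_mul_self, smul_eq_mul, mul_one, zero_add]
    rw [Finset.sum_range_succ, h2]
    conv_rhs => rw [hpq, ← h1]
    congr 1
    refine Finset.sum_congr rfl fun j hj => ?_
    have hj : j ≠ s := (Finset.mem_range.1 hj).ne
    rw [hpq, mul_add, map_add, mul_smul_comm, map_smul, unitIntegral_legendre_mul_legendre,
      if_neg hj, smul_zero, add_zero]

/-- The abscissae are all the zeros of the Legendre polynomial. -/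
lemma IsGaussLegendre.nodal_eq {k : ℕ} {c b : Fin k → ℝ} (h : IsGaussLegendre k c b) :
    Lagrange.nodal Finset.univ c = (legendre k).leadingCoeff⁻¹ • legendre k := by
  have hl : (legendre k).leadingCoeff ≠ 0 := leadingCoeff_ne_zero.2 (ne_zero_of_degree_gt
        (n := ⊥) (by rw [degree_legendre]; exact WithBot.bot_lt_coe k))
  have hm : ((legendre k).leadingCoeff⁻¹ • legendre k).Monic := by
    rw [Monic, smul_eq_C_mul, leadingCoeff_mul, leadingCoeff_C, inv_mul_cancel₀ hl]
  have hd : (Lagrange.nodal Finset.univ c).degree = k := by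
    simp [Lagrange.degree_nodal]
  have hd2 : ((legendre k).leadingCoeff⁻¹ • legendre k).degree = k := by
    rw [smul_eq_C_mul, degree_C_mul (inv_ne_zero hl), degree_legendre]
  -- Two monic polynomials of degree `k` differ by one of degree less than `k`, and this difference
  -- vanishes at `k` distinct nodes.
  refine Polynomial.eq_of_degree_sub_lt_of_eval_finset_eq (Finset.univ.image c) ?_ ?_
  · rw [Finset.card_image_of_injective _ h.strictMono.injective, Finset.card_univ,
      Fintype.card_fin, ← hd]
    exact degree_sub_lt_left (hd.trans hd2.symm) (Lagrange.nodal_monic).ne_zero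
      (by rw [hm.leadingCoeff, Lagrange.nodal_monic.leadingCoeff])
  · intro x hx
    obtain ⟨i, _, rfl⟩ := Finset.mem_image.1 hx
    rw [Lagrange.eval_nodal_at_node (Finset.mem_univ i), eval_smul, h.root i, smul_zero]

/-- The `k`-point Gauss-Legendre formula is exact for polynomials of degree less than `2k`. -/
lemma IsGaussLegendre.sum_eq_unitIntegral {k : ℕ} {c b : Fin k → ℝ} (h : IsGaussLegendre k c b)
    {p : ℝ[X]} (hp : p.degree < (2 * k : ℕ)) : ∑ i, b i * p.eval (c i) = unitIntegral p := by
  set N := Lagrange.nodal Finset.univ c with hN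
  have hNm : N.Monic := Lagrange.nodal_monic
  have hNd : N.degree = k := by simp [hN, Lagrange.degree_nodal]
  have hNn : N.natDegree = k := natDegree_eq_of_degree_eq_some hNd
  -- Both functionals kill `N * q`: the sum because the nodes are zeros of `N`, the integral by
  -- orthogonality to degrees below `k`. On the remainder the formula is interpolatory.
  set q := p /ₘ N with hq
  set r := p %ₘ N with hr
  have hpe : p = r + N * q := (modByMonic_add_div p N).symm
  have hrd : r.degree < k := hNd ▸ degree_modByMonic_lt p hNm
  have hqd : q.degree < k := by
    by_cases hq0 : q = 0
    · rw [hq0, degree_zero]; exact WithBot.bot_lt_coe k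
    · have hp0 : p ≠ 0 := by rintro rfl; exact hq0 (zero_divByMonic N)
      have h1 : p.natDegree < 2 * k := (natDegree_lt_iff_degree_lt hp0).2 hp
      have h2 := natDegree_divByMonic p hNm
      rw [hNn] at h2
      exact (natDegree_lt_iff_degree_lt hq0).1 (by rw [hq, h2]; omega)
  have hNq : unitIntegral (N * q) = 0 := by
    rw [hN, h.nodal_eq, smul_mul_assoc, map_smul, unitIntegral_legendre_mul_eq_zero hqd,
      smul_zero]
  have hI : r = ∑ i, r.eval (c i) • Lagrange.basis Finset.univ c i := by
    conv_lhs => rw [Lagrange.eq_interpolate (f := r) (s := Finset.univ) (v := c)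
      h.strictMono.injective.injOn (by simpa using hrd), Lagrange.interpolate_apply]
    simp only [smul_eq_C_mul]
  have hrI : unitIntegral r = ∑ i, b i * r.eval (c i) := by
    conv_lhs => rw [hI, map_sum]
    refine Finset.sum_congr rfl fun i _ => ?_
    rw [map_smul, smul_eq_mul, h.weight i, unitIntegral_apply, mul_comm]
  rw [hpe, map_add, hNq, add_zero, hrI]
  refine Finset.sum_congr rfl fun i _ => ?_
  rw [eval_add, eval_mul, hN, Lagrange.eval_nodal_at_node (Finset.mem_univ i), zero_mul, add_zero]

end ELIM

/-! ### Families scaling like `x ↦ f (x h)` and their Legendre coefficients. -/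

namespace ELIM

set_option linter.unusedSectionVars false

variable {G G₁ G₂ : Type*} [NormedAddCommGroup G] [NormedSpace ℝ G]
  [NormedAddCommGroup G₁] [NormedSpace ℝ G₁] [NormedAddCommGroup G₂] [NormedSpace ℝ G₂]

/-- A family `q h` of functions is `O(hⁿ)` as `h → 0⁺`, uniformly on `[0,1]`. -/
abbrev UnifO (q : ℝ → ℝ → G) (n : ℕ) : Prop :=
  (fun p : ℝ × ℝ => q p.1 p.2) =O[𝓝[>] (0 : ℝ) ×ˢ 𝓟 (Icc (0 : ℝ) 1)] fun p => p.1 ^ n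

lemma unifO_iff {q : ℝ → ℝ → G} {n : ℕ} :
    UnifO q n ↔ ∃ C, 0 ≤ C ∧ ∀ᶠ h in 𝓝[>] (0 : ℝ), ∀ x ∈ Icc (0 : ℝ) 1, ‖q h x‖ ≤ C * h ^ n := by
  rw [UnifO, isBigO_iff']
  constructor
  · rintro ⟨C, hC, h⟩
    refine ⟨C, hC.le, ?_⟩
    rw [eventually_prod_principal_iff] at h
    filter_upwards [h, self_mem_nhdsWithin] with t ht ht0 x hx
    have ht0 : (0 : ℝ) < t := ht0
    simpa [abs_of_pos ht0] using ht x hx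
  · rintro ⟨C, hC, h⟩
    refine ⟨C + 1, by positivity, ?_⟩
    rw [eventually_prod_principal_iff]
    filter_upwards [h, self_mem_nhdsWithin] with t ht ht0 x hx
    have ht0 : (0 : ℝ) < t := ht0
    refine (ht x hx).trans ?_
    rw [norm_pow, Real.norm_of_nonneg ht0.le]
    gcongr
    linarith

lemma isBigO_pow_of_le {m n : ℕ} (h : m ≤ n) :
    (fun t : ℝ => t ^ n) =O[𝓝[>] (0 : ℝ)] fun t => t ^ m := by
  refine IsBigO.of_bound 1 ?_
  filter_upwards [Ioo_mem_nhdsGT (zero_lt_one' ℝ)] with t ht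
  rw [norm_pow, norm_pow, Real.norm_of_nonneg ht.1.le, one_mul]
  exact pow_le_pow_of_le_one ht.1.le ht.2.le h

lemma UnifO.of_step {a : ℝ → G} {n : ℕ} (h : a =O[𝓝[>] (0 : ℝ)] fun t => t ^ n) :
    UnifO (fun t _ => a t) n :=
  h.comp_tendsto tendsto_fst

lemma UnifO.mono {q : ℝ → ℝ → G} {m n : ℕ} (h : UnifO q n) (hmn : m ≤ n) : UnifO q m :=
  h.trans (UnifO.of_step (isBigO_pow_of_le hmn))

lemma UnifO.of_continuous {φ : ℝ → G} (hφ : Continuous φ) : UnifO (fun _ x => φ x) 0 := by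
  obtain ⟨C, hC⟩ := isCompact_Icc.exists_bound_of_continuousOn (s := Icc (0 : ℝ) 1)
    hφ.continuousOn
  refine unifO_iff.2 ⟨max C 0, le_max_right _ _, Eventually.of_forall fun h x hx => ?_⟩
  rw [pow_zero, mul_one]
  exact (hC x hx).trans (le_max_left _ _)

lemma UnifO.const_smul_step {q : ℝ → ℝ → G} {n : ℕ} (h : UnifO q n) :
    UnifO (fun t x => t • q t x) (n + 1) := by
  have := (isBigO_refl (fun p : ℝ × ℝ => p.1) (𝓝[>] (0 : ℝ) ×ˢ 𝓟 (Icc (0 : ℝ) 1))).smul h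
  simpa [UnifO, pow_succ'] using this

lemma UnifO.smul {φ : ℝ → ℝ → ℝ} {q : ℝ → ℝ → G} {m n : ℕ} (hφ : UnifO φ m) (h : UnifO q n) :
    UnifO (fun t x => φ t x • q t x) (m + n) := by
  simpa [UnifO, pow_add] using IsBigO.smul hφ h

lemma UnifO.bilin (B : G₁ →L[ℝ] G₂ →L[ℝ] G) {p : ℝ → ℝ → G₁} {q : ℝ → ℝ → G₂} {m n : ℕ}
    (hp : UnifO p m) (hq : UnifO q n) : UnifO (fun t x => B (p t x) (q t x)) (m + n) := by
  have h1 := (hp.norm_left.mul hq.norm_left).const_mul_left ‖B‖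
  simp only [← pow_add] at h1
  refine IsBigO.trans (IsBigO.of_norm_le fun x => ?_) h1
  have := B.le_opNorm₂ (p x.1 x.2) (q x.1 x.2)
  rwa [mul_assoc] at this

lemma UnifO.at {q : ℝ → ℝ → G} {n : ℕ} (h : UnifO q n) {x : ℝ} (hx : x ∈ Icc (0 : ℝ) 1) :
    (fun t => q t x) =O[𝓝[>] (0 : ℝ)] fun t => t ^ n := by
  obtain ⟨C, -, hC⟩ := unifO_iff.1 h
  refine IsBigO.of_bound C ?_
  filter_upwards [hC, self_mem_nhdsWithin] with t ht ht0
  have ht0 : (0 : ℝ) < t := ht0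
  rw [norm_pow, Real.norm_of_nonneg ht0.le]
  exact ht x hx

lemma UnifO.integral {q : ℝ → ℝ → G} {n : ℕ} (h : UnifO q n) :
    (fun t => ∫ x in (0 : ℝ)..1, q t x) =O[𝓝[>] (0 : ℝ)] fun t => t ^ n := by
  obtain ⟨C, -, hC⟩ := unifO_iff.1 h
  refine IsBigO.of_bound C ?_
  filter_upwards [hC, self_mem_nhdsWithin] with t ht ht0
  have ht0 : (0 : ℝ) < t := ht0
  rw [norm_pow, Real.norm_of_nonneg ht0.le]
  refine (intervalIntegral.norm_integral_le_of_norm_le_const (C := C * t ^ n) fun x hx => ?_).trans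
    (by simp)
  rw [uIoc_of_le zero_le_one] at hx
  exact ht x ⟨hx.1.le, hx.2⟩

/-- Families of smooth functions whose derivatives up to order `N` scale as those of
`x ↦ f (x h)`. -/
structure ScaledTo (N : ℕ) (q : ℝ → ℝ → G) : Prop where
  smooth : ∀ h, ContDiff ℝ ∞ (q h)
  bound : ∀ n ≤ N, UnifO (fun h => iteratedDeriv n (q h)) n

lemma ScaledTo.mono {M N : ℕ} {q : ℝ → ℝ → G} (h : ScaledTo N q) (hMN : M ≤ N) : ScaledTo M q :=
  ⟨h.smooth, fun n hn => h.bound n (hn.trans hMN)⟩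

lemma ScaledTo.unifO {N : ℕ} {q : ℝ → ℝ → G} (h : ScaledTo N q) : UnifO q 0 := by
  simpa using h.bound 0 (Nat.zero_le _)

/-- The size of the coefficients `a` is irrelevant: the functionals applied later treat the
polynomial part exactly, and only the remainder is estimated. -/
lemma ScaledTo.exists_taylor {n : ℕ} {q : ℝ → ℝ → G} (hq : ScaledTo n q) :
    ∃ a : ℝ → ℕ → G, UnifO (fun h x => q h x - ∑ i ∈ Finset.range n, x ^ i • a h i) n := by
  rcases n with _ | n
  · exact ⟨0, by simpa using hq.bound 0 le_rfl⟩
  refine ⟨fun h i => ((i.factorial : ℝ)⁻¹) • iteratedDerivWithin i (q h) (Icc 0 1) 0, ?_⟩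
  obtain ⟨C, hC0, hC⟩ := unifO_iff.1 (hq.bound (n + 1) le_rfl)
  refine unifO_iff.2 ⟨C, hC0, ?_⟩
  filter_upwards [hC, self_mem_nhdsWithin] with t ht ht0 x hx
  have ht0 : (0 : ℝ) < t := ht0
  have hb := taylor_mean_remainder_bound (f := q t) (C := C * t ^ (n + 1)) (n := n)
    zero_le_one ((hq.smooth t).contDiffOn.of_le (by exact_mod_cast le_top)) hx fun y hy => by
      rw [iteratedDerivWithin_eq_iteratedDeriv (uniqueDiffOn_Icc zero_lt_one)
        ((hq.smooth t).contDiffAt.of_le (by exact_mod_cast le_top)) hy]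
      exact ht y hy
  rw [taylor_within_apply] at hb
  have e : ∑ i ∈ Finset.range (n + 1), x ^ i • ((i.factorial : ℝ)⁻¹ •
        iteratedDerivWithin i (q t) (Icc 0 1) 0) = ∑ i ∈ Finset.range (n + 1),
      ((i.factorial : ℝ)⁻¹ * (x - 0) ^ i) • iteratedDerivWithin i (q t) (Icc 0 1) 0 := by
    refine Finset.sum_congr rfl fun i _ => ?_
    rw [smul_smul, sub_zero, mul_comm]
  rw [e]
  refine hb.trans ((div_le_self ?_ ?_).trans (mul_le_of_le_one_right ?_ ?_))
  · have := hx.1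
    rw [sub_zero]; positivity
  · exact_mod_cast Nat.one_le_iff_ne_zero.2 n.factorial_ne_zero
  · positivity
  · rw [sub_zero]; exact pow_le_one₀ hx.1 hx.2

lemma integral_eval_smul_sum_pow [CompleteSpace G] (p : Polynomial ℝ) (n : ℕ) (a : ℕ → G) :
    ∫ x in (0 : ℝ)..1, p.eval x • ∑ i ∈ Finset.range n, x ^ i • a i =
      ∑ i ∈ Finset.range n, unitIntegral (p * Polynomial.X ^ i) • a i := by
  simp only [Finset.smul_sum, smul_smul, unitIntegral_apply, Polynomial.eval_mul,
    Polynomial.eval_pow, Polynomial.eval_X]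
  rw [intervalIntegral.integral_finsetSum]
  · simp only [intervalIntegral.integral_smul_const]
  · intro i _
    apply Continuous.intervalIntegrable
    fun_prop

lemma unifO_sum_eval_smul {ι : Type*} (w c : ι → ℝ) (hc : ∀ i, c i ∈ Icc (0 : ℝ) 1) (u : Finset ι)
    {q : ℝ → ℝ → G} {n : ℕ} (hq : UnifO q n) :
    (fun h => ∑ i ∈ u, w i • q h (c i)) =O[𝓝[>] (0 : ℝ)] fun t => t ^ n :=
  IsBigO.fun_sum fun i _ => (hq.at (hc i)).const_smul_left _

lemma unifO_integral_eval_smul (p : Polynomial ℝ) {q : ℝ → ℝ → G} {n : ℕ} (hq : UnifO q n) :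
    (fun h => ∫ x in (0 : ℝ)..1, p.eval x • q h x) =O[𝓝[>] (0 : ℝ)] fun t => t ^ n := by
  have := (UnifO.of_continuous p.continuous).smul hq
  rw [zero_add] at this
  exact this.integral

section Functionals

variable [CompleteSpace G] {q : ℝ → ℝ → G} {n : ℕ}

lemma integral_eval_smul_sub (p : Polynomial ℝ) {f g : ℝ → G} (hf : Continuous f)
    (hg : Continuous g) : ∫ x in (0 : ℝ)..1, p.eval x • (f x - g x) =
      (∫ x in (0 : ℝ)..1, p.eval x • f x) - ∫ x in (0 : ℝ)..1, p.eval x • g x := by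
  simp only [smul_sub]
  exact intervalIntegral.integral_sub ((p.continuous.smul hf).intervalIntegrable _ _)
    ((p.continuous.smul hg).intervalIntegrable _ _)

lemma degree_mul_X_pow_lt {p : Polynomial ℝ} {j i N : ℕ} (hp : p.degree ≤ j) (h : j + i < N) :
    (p * Polynomial.X ^ i).degree < (N : WithBot ℕ) := by
  rw [Polynomial.degree_mul, Polynomial.degree_X_pow]
  calc p.degree + (i : WithBot ℕ) ≤ j + i := by gcongr
    _ < N := by exact_mod_cast h

/-- The `j`-th Legendre coefficient. -/
lemma ScaledTo.integral_legendre (hq : ScaledTo n q) {j : ℕ} (hj : n ≤ j) :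
    (fun h => ∫ x in (0 : ℝ)..1, (legendre j).eval x • q h x)
      =O[𝓝[>] (0 : ℝ)] fun t => t ^ n := by
  obtain ⟨a, ha⟩ := hq.exists_taylor
  refine (unifO_integral_eval_smul (legendre j) ha).congr_left fun h => ?_
  rw [integral_eval_smul_sub _ (hq.smooth h).continuous (by fun_prop), integral_eval_smul_sum_pow,
    Finset.sum_eq_zero, sub_zero]
  intro i hi
  rw [unitIntegral_legendre_mul_eq_zero, zero_smul]
  rw [Polynomial.degree_X_pow]
  exact_mod_cast (Finset.mem_range.1 hi).trans_le hj

/-- The quadrature error. -/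
lemma ScaledTo.gauss_sub_integral (hq : ScaledTo n q) {k j : ℕ} {c b : Fin k → ℝ}
    (hcb : IsGaussLegendre k c b) (hj : j + n ≤ 2 * k) :
    (fun h => ∑ l, (b l * (legendre j).eval (c l)) • q h (c l) -
        ∫ x in (0 : ℝ)..1, (legendre j).eval x • q h x)
      =O[𝓝[>] (0 : ℝ)] fun t => t ^ n := by
  obtain ⟨a, ha⟩ := hq.exists_taylor
  -- On the Taylor polynomial the two functionals agree, the degrees being at most `j + n - 1 < 2k`;
  -- on the remainder each is `O(h^n)`.
  refine ((unifO_sum_eval_smul (fun l => b l * (legendre j).eval (c l)) c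
    (fun i => Ioo_subset_Icc_self (hcb.mem_Ioo i)) Finset.univ ha).sub
      (unifO_integral_eval_smul (legendre j) ha)).congr_left fun h => ?_
  rw [integral_eval_smul_sub _ (hq.smooth h).continuous (by fun_prop), integral_eval_smul_sum_pow]
  have e : ∑ l, (b l * (legendre j).eval (c l)) • ∑ i ∈ Finset.range n, c l ^ i • a h i =
      ∑ i ∈ Finset.range n, unitIntegral (legendre j * Polynomial.X ^ i) • a h i := by
    simp only [Finset.smul_sum]
    rw [Finset.sum_comm]
    refine Finset.sum_congr rfl fun i hi => ?_
    have hi := Finset.mem_range.1 hi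
    rw [← hcb.sum_eq_unitIntegral (degree_mul_X_pow_lt (N := 2 * k) (degree_legendre j).le (by omega)),
      Finset.sum_smul]
    refine Finset.sum_congr rfl fun l _ => ?_
    rw [smul_smul, Polynomial.eval_mul, Polynomial.eval_pow, Polynomial.eval_X, mul_assoc]
  simp only [smul_sub, Finset.sum_sub_distrib]
  rw [e]
  abel

/-- The `j`-th discrete Legendre coefficient. -/
lemma ScaledTo.gauss_legendre (hq : ScaledTo n q) {k j : ℕ} {c b : Fin k → ℝ}
    (hcb : IsGaussLegendre k c b) (hj : j + n ≤ 2 * k) (hn : n ≤ j) :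
    (fun h => ∑ l, (b l * (legendre j).eval (c l)) • q h (c l))
      =O[𝓝[>] (0 : ℝ)] fun t => t ^ n :=
  ((hq.gauss_sub_integral hcb hj).add (hq.integral_legendre hn)).congr_left fun h => by abel

/-- The truncated Legendre expansion on `[0,1]`. -/
noncomputable def legendreProj (s : ℕ) (f : ℝ → G) (x : ℝ) : G :=
  ∑ j ∈ Finset.range s, (legendre j).eval x • ∫ t in (0 : ℝ)..1, (legendre j).eval t • f t

lemma continuous_legendreProj (s : ℕ) (f : ℝ → G) : Continuous (legendreProj s f) := by
  unfold legendreProj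
  exact continuous_finsetSum _ fun j _ => (legendre j).continuous.smul continuous_const

lemma legendreProj_sub {s : ℕ} {f g : ℝ → G} (hf : Continuous f) (hg : Continuous g) (x : ℝ) :
    legendreProj s (fun t => f t - g t) x = legendreProj s f x - legendreProj s g x := by
  simp only [legendreProj]
  rw [← Finset.sum_sub_distrib]
  refine Finset.sum_congr rfl fun j _ => ?_
  rw [integral_eval_smul_sub _ hf hg, smul_sub]

lemma legendreProj_sum_pow (s : ℕ) (a : ℕ → G) (x : ℝ) :
    legendreProj s (fun t => ∑ i ∈ Finset.range s, t ^ i • a i) x =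
      ∑ i ∈ Finset.range s, x ^ i • a i := by
  simp only [legendreProj, integral_eval_smul_sum_pow]
  simp only [Finset.smul_sum, smul_smul]
  rw [Finset.sum_comm]
  refine Finset.sum_congr rfl fun i hi => ?_
  rw [← Finset.sum_smul]
  congr 1
  have h := congrArg (Polynomial.eval x) (sum_legendre_expansion (s := s) (p := Polynomial.X ^ i)
    (by rw [Polynomial.degree_X_pow]; exact_mod_cast Finset.mem_range.1 hi))
  rw [Polynomial.eval_finsetSum] at h
  simp only [Polynomial.eval_smul, smul_eq_mul, Polynomial.eval_pow, Polynomial.eval_X] at h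
  rw [← h]
  exact Finset.sum_congr rfl fun j _ => mul_comm _ _

lemma unifO_legendreProj (s : ℕ) (hq : UnifO q n) :
    UnifO (fun h => legendreProj s (q h)) n := by
  unfold legendreProj
  refine IsBigO.fun_sum fun j _ => ?_
  have := (UnifO.of_continuous (legendre j).continuous).smul
    (UnifO.of_step (unifO_integral_eval_smul (legendre j) hq))
  rwa [zero_add] at this

lemma ScaledTo.sub_legendreProj {s : ℕ} (hq : ScaledTo s q) :
    UnifO (fun h x => q h x - legendreProj s (q h) x) s := by
  obtain ⟨a, ha⟩ := hq.exists_taylor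
  refine (IsBigO.sub ha (unifO_legendreProj s ha)).congr_left fun p => ?_
  beta_reduce
  rw [legendreProj_sub (hq.smooth _).continuous (by fun_prop), legendreProj_sum_pow]
  abel

lemma integral_legendre_smul_sub_legendreProj {s j : ℕ} (hj : j < s) {f : ℝ → G}
    (hf : Continuous f) :
    ∫ x in (0 : ℝ)..1, (legendre j).eval x • (f x - legendreProj s f x) = 0 := by
  rw [integral_eval_smul_sub _ hf (continuous_legendreProj s f)]
  simp only [legendreProj, Finset.smul_sum, smul_smul]
  rw [intervalIntegral.integral_finsetSum]
  · simp only [intervalIntegral.integral_smul_const, ← Polynomial.eval_mul]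
    simp only [← unitIntegral_apply, unitIntegral_legendre_mul_legendre, ite_smul, one_smul,
      zero_smul]
    rw [Finset.sum_ite_eq, if_pos (Finset.mem_range.2 hj), sub_self]
  · intro i _
    apply Continuous.intervalIntegrable
    fun_prop

/-- The remainder of `q` is orthogonal to polynomials of degree less than `s`, so `p` may be
replaced by its own remainder. Both remainders are `O(h^s)`, which doubles the order. -/
lemma ScaledTo.integral_bilin_sub_legendreProj [CompleteSpace G₁] [CompleteSpace G₂] {s : ℕ}
    (B : G₁ →L[ℝ] G₂ →L[ℝ] G)
    {p : ℝ → ℝ → G₁} {q : ℝ → ℝ → G₂} (hp : ScaledTo s p) (hq : ScaledTo s q) :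
    (fun h => ∫ x in (0 : ℝ)..1, B (p h x) (q h x - legendreProj s (q h) x))
      =O[𝓝[>] (0 : ℝ)] fun t => t ^ (2 * s) := by
  have h1 := (UnifO.bilin B hp.sub_legendreProj hq.sub_legendreProj).integral
  rw [← two_mul] at h1
  refine h1.congr_left fun h => ?_
  have hpc := (hp.smooth h).continuous
  have hqc : Continuous fun x => q h x - legendreProj s (q h) x :=
    (hq.smooth h).continuous.sub (continuous_legendreProj s (q h))
  have hpp := continuous_legendreProj s (p h)
  simp only [map_sub B, _root_.sub_apply]
  rw [intervalIntegral.integral_sub]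
  · rw [sub_eq_self]
    simp only [legendreProj, map_sum, _root_.sum_apply, map_smul,
      _root_.smul_apply]
    rw [intervalIntegral.integral_finsetSum]
    · refine Finset.sum_eq_zero fun j hj => ?_
      have h0 := integral_legendre_smul_sub_legendreProj (Finset.mem_range.1 hj)
        (hq.smooth h).continuous
      set v := ∫ t in (0 : ℝ)..1, (legendre j).eval t • p h t
      have h2 := (B v).intervalIntegral_comp_comm (μ := MeasureTheory.volume)
        (((legendre j).continuous.smul hqc).intervalIntegrable 0 1)
      simp only [legendreProj, Pi.smul_apply'] at h0 h2
      rw [h0, map_zero] at h2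
      simpa only [map_smul] using h2
    · intro i _
      apply Continuous.intervalIntegrable
      have := hqc
      simp only [legendreProj] at this
      exact (legendre i).continuous.smul
        ((B (∫ t in (0 : ℝ)..1, (legendre i).eval t • p h t)).continuous.comp this)
  · exact ((B.continuous.comp hpc).clm_apply hqc).intervalIntegrable _ _
  · apply Continuous.intervalIntegrable
    exact (B.continuous.comp hpp).clm_apply hqc

end Functionals

end ELIM

/-! ### Stability of the scaling under smooth maps, products and integration. -/

namespace ELIM

set_option linter.unusedSectionVars false

variable {E G G₁ G₂ : Type*} [NormedAddCommGroup E] [NormedSpace ℝ E]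
  [NormedAddCommGroup G] [NormedSpace ℝ G]
  [NormedAddCommGroup G₁] [NormedSpace ℝ G₁] [NormedAddCommGroup G₂] [NormedSpace ℝ G₂]

/-- Smooth maps all of whose derivatives are bounded. -/
structure SmoothBdd (F : E → G) : Prop where
  smooth : ContDiff ℝ ∞ F
  bound : ∀ n : ℕ, ∃ C, ∀ x, ‖iteratedFDeriv ℝ n F x‖ ≤ C

lemma SmoothBdd.of_hasCompactSupport {F : E → G} (hF : ContDiff ℝ ∞ F)
    (hc : HasCompactSupport F) : SmoothBdd F :=
  ⟨hF, fun n => (hc.iteratedFDeriv n).exists_bound_of_continuous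
    (hF.continuous_iteratedFDeriv (by exact_mod_cast le_top))⟩

lemma SmoothBdd.fderiv {F : E → G} (hF : SmoothBdd F) : SmoothBdd (fderiv ℝ F) where
  smooth := hF.smooth.fderiv_right (by exact_mod_cast le_top)
  bound n := by
    obtain ⟨C, hC⟩ := hF.bound (n + 1)
    exact ⟨C, fun x => by rw [norm_iteratedFDeriv_fderiv]; exact hC x⟩

lemma SmoothBdd.exists_norm_le {F : E → G} (hF : SmoothBdd F) : ∃ C, 0 ≤ C ∧ ∀ x, ‖F x‖ ≤ C := by
  obtain ⟨C, hC⟩ := hF.bound 0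
  exact ⟨C, (norm_nonneg _).trans (hC 0), fun x => by simpa using hC x⟩

lemma SmoothBdd.exists_lipschitz {F : E → G} (hF : SmoothBdd F) :
    ∃ C, 0 ≤ C ∧ ∀ x y, ‖F x - F y‖ ≤ C * ‖x - y‖ := by
  obtain ⟨C, hC0, hC⟩ := hF.fderiv.exists_norm_le
  refine ⟨C, hC0, fun x y => ?_⟩
  exact convex_univ.norm_image_sub_le_of_norm_fderiv_le
    (fun z _ => (hF.smooth.differentiable (by simp)).differentiableAt) (fun z _ => hC z)
    (mem_univ y) (mem_univ x)

lemma SmoothBdd.exists_taylor_two {F : E → G} (hF : SmoothBdd F) :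
    ∃ C, 0 ≤ C ∧ ∀ x y, ‖F y - F x - _root_.fderiv ℝ F x (y - x)‖ ≤ C * ‖y - x‖ ^ 2 := by
  obtain ⟨C, hC0, hC⟩ := hF.fderiv.exists_lipschitz
  refine ⟨C, hC0, fun x y => ?_⟩
  rw [sq, ← mul_assoc]
  refine (convex_segment x y).norm_image_sub_le_of_norm_fderiv_le'
    (fun z _ => (hF.smooth.differentiable (by simp)).differentiableAt) (fun z hz => ?_)
    (left_mem_segment ℝ x y) (right_mem_segment ℝ x y)
  refine (hC z x).trans ?_
  gcongr
  obtain ⟨a, b, ha, hb, hab, rfl⟩ := hz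
  have : a • x + b • y - x = b • (y - x) := by
    rw [show a = 1 - b by linarith]; module
  rw [this, norm_smul, Real.norm_of_nonneg hb]
  exact mul_le_of_le_one_left (norm_nonneg _) (by linarith)

lemma ScaledTo.comp {N : ℕ} {F : E → G} (hF : SmoothBdd F) {V : ℝ → ℝ → E} (hV : ScaledTo N V) :
    ScaledTo N (fun h x => F (V h x)) where
  smooth h := hF.smooth.comp (hV.smooth h)
  bound n hn := by
    choose C hC using hF.bound
    have hV' : ∀ i : ℕ, ∃ D, 0 ≤ D ∧ (i ≤ N → ∀ᶠ h in 𝓝[>] (0 : ℝ), ∀ x ∈ Icc (0 : ℝ) 1,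
        ‖iteratedDeriv i (V h) x‖ ≤ D * h ^ i) := by
      intro i
      by_cases hi : i ≤ N
      · obtain ⟨D, h0, hD⟩ := unifO_iff.1 (hV.bound i hi)
        exact ⟨D, h0, fun _ => hD⟩
      · exact ⟨0, le_rfl, fun h => absurd h hi⟩
    choose D hD0 hD using hV'
    have hC0 : ∀ i, 0 ≤ C i := fun i => (norm_nonneg _).trans (hC i 0)
    set K := ∑ i ∈ Finset.range (n + 1), C i with hK
    -- The bound for derivatives of a composition needs the `i`-th inner derivative below `(M h)^i`;
    -- the summand `1` gives `M ≥ 1`, so `D i ≤ M ≤ M^i` for `i ≥ 1`.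
    set M := 1 + ∑ i ∈ Finset.range (n + 1), D i with hM
    have hM1 : 1 ≤ M := le_add_of_nonneg_right (Finset.sum_nonneg fun i _ => hD0 i)
    have hK0 : 0 ≤ K := Finset.sum_nonneg fun i _ => hC0 i
    refine unifO_iff.2 ⟨n.factorial * K * M ^ n, by positivity, ?_⟩
    have hall : ∀ᶠ h in 𝓝[>] (0 : ℝ), ∀ i ∈ Finset.range (n + 1), ∀ x ∈ Icc (0 : ℝ) 1,
        ‖iteratedDeriv i (V h) x‖ ≤ D i * h ^ i :=
      (Finset.eventually_all _).2 fun i hi =>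
        hD i ((Nat.lt_succ_iff.1 (Finset.mem_range.1 hi)).trans hn)
    filter_upwards [hall, self_mem_nhdsWithin] with h hh h0 x hx
    have h0 : (0 : ℝ) < h := h0
    rw [← norm_iteratedFDeriv_eq_norm_iteratedDeriv]
    refine (norm_iteratedFDeriv_comp_le (n := n) hF.smooth (hV.smooth h)
      (by exact_mod_cast le_top) x (C := K) (D := M * h)
      (fun i hi => (hC i _).trans ?_) fun i h1 hi => ?_).trans (le_of_eq (by rw [mul_pow, ← mul_assoc]))
    · exact Finset.single_le_sum (f := C) (fun i _ => hC0 i)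
        (Finset.mem_range.2 (Nat.lt_succ_of_le hi))
    · rw [norm_iteratedFDeriv_eq_norm_iteratedDeriv, mul_pow]
      have hi' : i ∈ Finset.range (n + 1) := Finset.mem_range.2 (Nat.lt_succ_of_le hi)
      refine (hh i hi' x hx).trans ?_
      gcongr
      have h2 : D i ≤ ∑ i ∈ Finset.range (n + 1), D i :=
        Finset.single_le_sum (f := D) (fun i _ => hD0 i) hi'
      calc D i ≤ M := by linarith
        _ ≤ M ^ i := le_self_pow₀ hM1 (by omega)

lemma ScaledTo.bilin {N : ℕ} (B : G₁ →L[ℝ] G₂ →L[ℝ] G) {p : ℝ → ℝ → G₁} {q : ℝ → ℝ → G₂}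
    (hp : ScaledTo N p) (hq : ScaledTo N q) : ScaledTo N (fun h x => B (p h x) (q h x)) where
  smooth h := (B.contDiff.comp (hp.smooth h)).clm_apply (hq.smooth h)
  bound n hn := by
    have h1 : (fun z : ℝ × ℝ => ‖B‖ * ∑ i ∈ Finset.range (n + 1),
        (n.choose i : ℝ) * ‖iteratedDeriv i (p z.1) z.2‖ * ‖iteratedDeriv (n - i) (q z.1) z.2‖)
        =O[𝓝[>] (0 : ℝ) ×ˢ 𝓟 (Icc (0 : ℝ) 1)] fun z => z.1 ^ n := by
      refine IsBigO.const_mul_left (IsBigO.fun_sum fun i hi => ?_) _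
      have hi := Nat.lt_succ_iff.1 (Finset.mem_range.1 hi)
      have h2 := ((hp.bound i (hi.trans hn)).norm_left.const_mul_left (n.choose i : ℝ)).mul
        (hq.bound (n - i) ((Nat.sub_le _ _).trans hn)).norm_left
      simpa only [← pow_add, Nat.add_sub_cancel' hi] using h2
    refine IsBigO.trans (IsBigO.of_norm_le fun z => ?_) h1
    simp only [← norm_iteratedFDeriv_eq_norm_iteratedDeriv]
    exact B.norm_iteratedFDeriv_le_of_bilinear (hp.smooth z.1) (hq.smooth z.1) z.2
      (by exact_mod_cast le_top)

lemma ScaledTo.of_deriv {N : ℕ} {q q' : ℝ → ℝ → G} (h0 : UnifO q 0)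
    (hd : ∀ h x, HasDerivAt (q h) (q' h x) x) (hs : ∀ h, ContDiff ℝ ∞ (q' h))
    (hq' : ∀ n < N, UnifO (fun h => iteratedDeriv n (q' h)) (n + 1)) : ScaledTo N q where
  smooth h := by
    rw [contDiff_infty_iff_deriv]
    exact ⟨fun x => (hd h x).differentiableAt, by rw [funext fun x => (hd h x).deriv]; exact hs h⟩
  bound n hn := by
    rcases n with _ | n
    · simpa using h0
    · refine (hq' n hn).congr_left fun z => ?_
      beta_reduce
      rw [iteratedDeriv_succ', funext fun x => (hd z.1 x).deriv]

lemma scaledTo_const (N : ℕ) (v : G) : ScaledTo N (fun _ _ => v) :=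
  .of_deriv (q' := fun _ _ => 0) (.of_continuous continuous_const) (fun _ x => hasDerivAt_const x v)
    (fun _ => contDiff_const) fun n _ => by
      refine (isBigO_zero _ _).congr_left fun z => ?_
      simp

lemma UnifO.integral_right {q : ℝ → ℝ → G} {n : ℕ} (h : UnifO q n) :
    UnifO (fun t x => ∫ y in x..1, q t y) n := by
  obtain ⟨C, hC0, hC⟩ := unifO_iff.1 h
  refine unifO_iff.2 ⟨C, hC0, ?_⟩
  filter_upwards [hC, self_mem_nhdsWithin] with t ht ht0 x hx
  have ht0 : (0 : ℝ) < t := ht0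
  refine (intervalIntegral.norm_integral_le_of_norm_le_const (C := C * t ^ n)
    fun y hy => ?_).trans ?_
  · rw [uIoc_of_le hx.2] at hy
    exact ht y ⟨hx.1.trans hy.1.le, hy.2⟩
  · rw [abs_of_nonneg (by linarith [hx.2])]
    exact mul_le_of_le_one_right (by positivity) (by linarith [hx.1])

lemma hasDerivAt_add_smul_integral_right [CompleteSpace G] {q : ℝ → G} (hq : Continuous q) (v : G)
    (h x : ℝ) : HasDerivAt (fun x => v + h • ∫ y in x..1, q y) (-(h • q x)) x := by
  have := (intervalIntegral.integral_hasDerivAt_left (hq.intervalIntegrable x 1)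
    (hq.stronglyMeasurableAtFilter _ _) hq.continuousAt).const_smul h
  simpa using this.const_add v

lemma ScaledTo.add_smul_integral_right [CompleteSpace G] {N : ℕ} {q : ℝ → ℝ → G}
    (hq : ScaledTo N q) (v : G) : ScaledTo N (fun h x => v + h • ∫ y in x..1, q h y) := by
  refine .of_deriv (q' := fun h x => -(h • q h x)) ?_
    (fun h x => hasDerivAt_add_smul_integral_right (hq.smooth h).continuous v h x)
    (fun h => ((hq.smooth h).const_smul h).neg) fun n hn => ?_
  · refine IsBigO.add (UnifO.of_continuous continuous_const) ?_
    exact hq.unifO.integral_right.const_smul_step.mono (Nat.zero_le _)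
  · refine (hq.bound n hn.le).const_smul_step.neg_left.congr_left fun z => ?_
    beta_reduce
    rw [iteratedDeriv_fun_neg, iteratedDeriv_fun_const_smul]
    exact (hq.smooth _).contDiffAt.of_le (by exact_mod_cast le_top)

/-! ### An approximate solution of the adjoint equation. -/

section Adjoint

variable [CompleteSpace E]

/-- Neumann iterates for the backward equation `Z' = -h Z A`, `Z(1) = 1`. -/
noncomputable def neumann (A : ℝ → ℝ → E →L[ℝ] E) : ℕ → ℝ → ℝ → E →L[ℝ] E
  | 0 => fun _ _ => ContinuousLinearMap.id ℝ E
  | m + 1 => fun h x => ContinuousLinearMap.id ℝ E +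
      h • ∫ y in x..1, ContinuousLinearMap.compL ℝ E E E (neumann A m h y) (A h y)

variable {A : ℝ → ℝ → E →L[ℝ] E} {N : ℕ}

lemma neumann_succ_apply (A : ℝ → ℝ → E →L[ℝ] E) (m : ℕ) (h x : ℝ) :
    neumann A (m + 1) h x = ContinuousLinearMap.id ℝ E +
      h • ∫ y in x..1, ContinuousLinearMap.compL ℝ E E E (neumann A m h y) (A h y) := rfl

lemma scaledTo_neumann (hA : ScaledTo N A) (m : ℕ) : ScaledTo N (neumann A m) := by
  induction m with
  | zero => exact scaledTo_const N _
  | succ m ih => exact (ih.bilin (ContinuousLinearMap.compL ℝ E E E) hA).add_smul_integral_right _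

lemma neumann_one (A : ℝ → ℝ → E →L[ℝ] E) (m : ℕ) (h : ℝ) :
    neumann A m h 1 = ContinuousLinearMap.id ℝ E := by
  cases m <;> simp [neumann]

lemma unifO_neumann_sub (hA : ScaledTo N A) (m : ℕ) :
    UnifO (fun h x => neumann A (m + 1) h x - neumann A m h x) (m + 1) := by
  induction m with
  | zero =>
    refine (((UnifO.of_continuous continuous_const).bilin (ContinuousLinearMap.compL ℝ E E E)
      (p := fun _ _ => ContinuousLinearMap.id ℝ E)
      hA.unifO).integral_right.const_smul_step).congr_left fun z => ?_
    simp [neumann]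
  | succ m ih =>
    refine ((ih.bilin (ContinuousLinearMap.compL ℝ E E E)
      hA.unifO).integral_right.const_smul_step).congr_left fun z => ?_
    beta_reduce
    rw [neumann_succ_apply A (m + 1), neumann_succ_apply A m z.1 z.2, add_sub_add_left_eq_sub, ← smul_sub, ← intervalIntegral.integral_sub]
    · simp only [map_sub, _root_.sub_apply]
    · exact (((scaledTo_neumann hA (m + 1)).bilin (ContinuousLinearMap.compL ℝ E E E)
        hA).smooth z.1).continuous.intervalIntegrable _ _
    · exact (((scaledTo_neumann hA m).bilin (ContinuousLinearMap.compL ℝ E E E)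
        hA).smooth z.1).continuous.intervalIntegrable _ _

/-- The derivative of an iterate involves the preceding one, so the defect `R` is `h` times the
difference of consecutive iterates composed with `A`, and each iteration gains a power of `h`. A
finite iterate suffices, and its scaling follows by induction. -/
lemma exists_approx_adjoint (hA : ScaledTo N A) (m : ℕ) :
    ∃ Z R : ℝ → ℝ → E →L[ℝ] E, ScaledTo N Z ∧ (∀ h, Z h 1 = ContinuousLinearMap.id ℝ E) ∧
      UnifO R m ∧ ∀ h x, HasDerivAt (Z h) (R h x - h • (Z h x).comp (A h x)) x := by
  refine ⟨neumann A (m + 1), fun h x => h • ContinuousLinearMap.compL ℝ E E E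
      (neumann A (m + 1) h x - neumann A m h x) (A h x), scaledTo_neumann hA _,
    neumann_one A _, ?_, fun h x => ?_⟩
  · exact ((unifO_neumann_sub hA m).bilin (ContinuousLinearMap.compL ℝ E E E)
      hA.unifO).const_smul_step.mono (by omega)
  · have := hasDerivAt_add_smul_integral_right
      (((scaledTo_neumann hA m).bilin (ContinuousLinearMap.compL ℝ E E E)
        hA).smooth h).continuous (ContinuousLinearMap.id ℝ E) h x
    refine this.congr_deriv ?_
    beta_reduce
    rw [map_sub, _root_.sub_apply, ContinuousLinearMap.compL_apply,
      ContinuousLinearMap.compL_apply, smul_sub]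
    abel

end Adjoint

end ELIM

namespace ELIM

set_option linter.unusedSectionVars false

/-! ### Linear systems with determinant bounded below. -/

section Determinants

variable {ι : Type*} [Fintype ι] [DecidableEq ι] {l : Filter ℝ}

lemma isBigO_one_finset_prod (u : Finset ι) {a : ℝ → ι → ℝ}
    (ha : ∀ i, (fun h => a h i) =O[l] fun _ => (1 : ℝ)) :
    (fun h => ∏ i ∈ u, a h i) =O[l] fun _ => (1 : ℝ) := by
  induction u using Finset.induction_on with
  | empty => simpa using isBigO_refl (fun _ : ℝ => (1 : ℝ)) l
  | insert i u hi ih =>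
    simp only [Finset.prod_insert hi]
    simpa using (ha i).mul ih

lemma isBigO_finset_prod_sub (u : Finset ι) {a b : ℝ → ι → ℝ} {g : ℝ → ℝ}
    (ha : ∀ i, (fun h => a h i) =O[l] fun _ => (1 : ℝ))
    (hb : ∀ i, (fun h => b h i) =O[l] fun _ => (1 : ℝ))
    (hab : ∀ i, (fun h => a h i - b h i) =O[l] g) :
    (fun h => ∏ i ∈ u, a h i - ∏ i ∈ u, b h i) =O[l] g := by
  induction u using Finset.induction_on with
  | empty => simpa using isBigO_zero _ _
  | insert i u hi ih =>
    have h1 := (ha i).mul ih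
    have h2 := (hab i).mul (isBigO_one_finset_prod u hb)
    simp only [one_mul, mul_one] at h1 h2
    refine (h1.add h2).congr_left fun h => ?_
    rw [Finset.prod_insert hi, Finset.prod_insert hi]
    ring

lemma isBigO_one_det {M : ℝ → Matrix ι ι ℝ}
    (hM : ∀ i j, (fun h => M h i j) =O[l] fun _ => (1 : ℝ)) :
    (fun h => (M h).det) =O[l] fun _ => (1 : ℝ) := by
  simp only [Matrix.det_apply']
  exact IsBigO.fun_sum fun σ _ => (isBigO_one_finset_prod _ fun i => hM _ _).const_mul_left _

lemma isBigO_det_sub {M N : ℝ → Matrix ι ι ℝ} {g : ℝ → ℝ}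
    (hM : ∀ i j, (fun h => M h i j) =O[l] fun _ => (1 : ℝ))
    (hN : ∀ i j, (fun h => N h i j) =O[l] fun _ => (1 : ℝ))
    (hMN : ∀ i j, (fun h => M h i j - N h i j) =O[l] g) :
    (fun h => (M h).det - (N h).det) =O[l] g := by
  simp only [Matrix.det_apply', ← Finset.sum_sub_distrib, ← mul_sub]
  exact IsBigO.fun_sum fun σ _ => (isBigO_finset_prod_sub _ (fun i => hM _ _) (fun i => hN _ _)
    fun i => hMN _ _).const_mul_left _

/-- Cramer's rule: `det M • v = adj M (M v)`, with a bounded adjugate. -/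
lemma isBigO_of_mulVec {M : ℝ → Matrix ι ι ℝ} {v : ℝ → ι → ℝ} {g : ℝ → ℝ} {κ : ℝ} (hκ : 0 < κ)
    (hM : ∀ i j, (fun h => M h i j) =O[l] fun _ => (1 : ℝ))
    (hdet : ∀ᶠ h in l, κ ≤ |(M h).det|)
    (hv : ∀ i, (fun h => (M h).mulVec (v h) i) =O[l] g) (i : ι) :
    (fun h => v h i) =O[l] g := by
  have hadj : ∀ i j, (fun h => (M h).adjugate i j) =O[l] fun _ => (1 : ℝ) := by
    intro i j
    simp only [Matrix.adjugate_apply]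
    refine isBigO_one_det fun a b => ?_
    by_cases hab : a = j
    · subst hab
      simp only [Matrix.updateRow_self]
      exact isBigO_const_const _ one_ne_zero _
    · simp only [Matrix.updateRow_ne hab]
      exact hM a b
  have h1 : (fun h => (M h).det * v h i) =O[l] g := by
    have h2 : (fun h => ∑ j, (M h).adjugate i j * (M h).mulVec (v h) j) =O[l] g :=
      IsBigO.fun_sum fun j _ => by simpa using (hadj i j).mul (hv j)
    refine h2.congr_left fun h => ?_
    have h3 : (M h).adjugate.mulVec ((M h).mulVec (v h)) = (M h).det • v h := by
      rw [Matrix.mulVec_mulVec, Matrix.adjugate_mul, Matrix.smul_mulVec, Matrix.one_mulVec]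
    have h4 := congrFun h3 i
    simpa [Matrix.mulVec, dotProduct] using h4
  refine IsBigO.trans (IsBigO.of_bound κ⁻¹ ?_) h1
  filter_upwards [hdet] with h hh
  rw [norm_mul, Real.norm_eq_abs (M h).det, inv_mul_eq_div, le_div_iff₀ hκ, mul_comm]
  gcongr

/-- After division by `h^p` the matrices are bounded and differ by `O(h)`, so their determinants
have difference tending to zero and that of `M` eventually exceeds `κ / 2` in absolute value. -/
lemma isBigO_of_mulVec_of_det {M N : ℝ → Matrix ι ι ℝ} {v : ℝ → ι → ℝ} {p q : ℕ} {κ : ℝ}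
    (hκ : 0 < κ)
    (hM : ∀ i j, (fun h => M h i j) =O[𝓝[>] (0 : ℝ)] fun h => h ^ p)
    (hMN : ∀ i j, (fun h => M h i j - N h i j) =O[𝓝[>] (0 : ℝ)] fun h => h ^ (p + 1))
    (hdet : ∀ᶠ h in 𝓝[>] (0 : ℝ), κ * (h ^ p) ^ Fintype.card ι ≤ |(N h).det|)
    (hv : ∀ i, (fun h => (M h).mulVec (v h) i) =O[𝓝[>] (0 : ℝ)] fun h => h ^ (p + q)) (i : ι) :
    (fun h => v h i) =O[𝓝[>] (0 : ℝ)] fun h => h ^ q := by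
  have hpos : ∀ᶠ h in 𝓝[>] (0 : ℝ), 0 < h := self_mem_nhdsWithin
  have hscale : ∀ {φ : ℝ → ℝ} {m : ℕ}, φ =O[𝓝[>] (0 : ℝ)] (fun h => h ^ (p + m)) →
      (fun h => (h ^ p)⁻¹ * φ h) =O[𝓝[>] (0 : ℝ)] fun h => h ^ m := by
    intro φ m hφ
    refine ((isBigO_refl (fun h : ℝ => (h ^ p)⁻¹) _).mul hφ).congr' EventuallyEq.rfl ?_
    filter_upwards [hpos] with h hh
    rw [pow_add]
    field_simp
  have hM' : ∀ i j, (fun h => ((h ^ p)⁻¹ • M h) i j) =O[𝓝[>] (0 : ℝ)] fun _ => (1 : ℝ) :=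
    fun i j => by simpa using hscale (m := 0) (hM i j)
  have hMN' : ∀ i j, (fun h => ((h ^ p)⁻¹ • M h) i j - ((h ^ p)⁻¹ • N h) i j)
      =O[𝓝[>] (0 : ℝ)] fun h => h := fun i j => by
    simpa [mul_sub] using hscale (m := 1) (hMN i j)
  have hh0 : Tendsto (fun h : ℝ => h) (𝓝[>] 0) (𝓝 0) := tendsto_nhdsWithin_of_tendsto_nhds
    tendsto_id
  have hN' : ∀ i j, (fun h => ((h ^ p)⁻¹ • N h) i j) =O[𝓝[>] (0 : ℝ)] fun _ => (1 : ℝ) := by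
    intro i j
    refine ((hM' i j).sub ((hMN' i j).trans (hh0.isBigO_one ℝ))).congr_left fun h => ?_
    ring
  have hd := ((isBigO_det_sub hM' hN' hMN').trans_tendsto hh0).norm
  rw [norm_zero] at hd
  have hev := hd.eventually (gt_mem_nhds (half_pos hκ))
  refine isBigO_of_mulVec (half_pos hκ) hM' ?_ (fun i => ?_) i
  · filter_upwards [hev, hdet, hpos] with h h1 h2 h3
    have h4 : κ ≤ |((h ^ p)⁻¹ • N h).det| := by
      rw [Matrix.det_smul, abs_mul, inv_pow, abs_of_pos (by positivity), inv_mul_eq_div,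
        le_div_iff₀ (by positivity)]
      exact h2
    rw [Real.norm_eq_abs] at h1
    have h5 := abs_sub_abs_le_abs_sub ((h ^ p)⁻¹ • N h).det ((h ^ p)⁻¹ • M h).det
    rw [abs_sub_comm] at h5
    linarith
  · simpa [Matrix.smul_mulVec] using hscale (hv i)

end Determinants

/-! ### Perturbed collocation steps: scaling, defects and residual. -/

section Step

variable {E : Type*} [NormedAddCommGroup E] [NormedSpace ℝ E] [CompleteSpace E]

/-- The polynomial with derivative `h ∑_{j<s} P_j d_j` and initial value `y₀`. -/
noncomputable def stepPoly (s : ℕ) (y₀ : E) (h : ℝ) (d : ℕ → E) (x : ℝ) : E :=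
  y₀ + h • ∑ j ∈ Finset.range s, (∫ t in (0 : ℝ)..x, (legendre j).eval t) • d j

lemma stepPoly_zero (s : ℕ) (y₀ : E) (h : ℝ) (d : ℕ → E) : stepPoly s y₀ h d 0 = y₀ := by
  simp [stepPoly]

lemma hasDerivAt_stepPoly (s : ℕ) (y₀ : E) (h : ℝ) (d : ℕ → E) (x : ℝ) :
    HasDerivAt (stepPoly s y₀ h d)
      (h • ∑ j ∈ Finset.range s, (legendre j).eval x • d j) x := by
  refine HasDerivAt.const_add _ (HasDerivAt.fun_const_smul h (HasDerivAt.fun_sum fun j _ => ?_))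
  exact (intervalIntegral.integral_hasDerivAt_right
    ((legendre j).continuous.intervalIntegrable _ _)
    ((legendre j).continuous.stronglyMeasurableAtFilter _ _)
    (legendre j).continuous.continuousAt).smul_const (d j)

lemma unifO_stepPoly_sub (s : ℕ) (y₀ : E) {d : ℝ → ℕ → E} (hd : ∀ j < s, (fun h => d h j) =O[𝓝[>] (0 : ℝ)] fun h => h ^ 0) :
    UnifO (fun h x => stepPoly s y₀ h (d h) x - y₀) 1 := by
  have h1 : UnifO (fun h x => ∑ j ∈ Finset.range s,
      (∫ t in (0 : ℝ)..x, (legendre j).eval t) • d h j) 0 := by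
    refine IsBigO.fun_sum fun j hj => ?_
    have hc : Continuous fun x => ∫ t in (0 : ℝ)..x, (legendre j).eval t :=
      intervalIntegral.continuous_primitive
        (fun a b => (legendre j).continuous.intervalIntegrable a b) 0
    exact (UnifO.of_continuous hc).smul (UnifO.of_step (hd j (Finset.mem_range.1 hj)))
  exact h1.const_smul_step.congr_left fun z => by simp [stepPoly]

lemma iteratedDeriv_smul_sum_eval (n s : ℕ) (h : ℝ) (P : ℕ → Polynomial ℝ) (d : ℕ → E) (x : ℝ) :
    iteratedDeriv n (fun x => h • ∑ j ∈ Finset.range s, (P j).eval x • d j) x =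
      h • ∑ j ∈ Finset.range s, (Polynomial.derivative^[n] (P j)).eval x • d j := by
  induction n generalizing P with
  | zero => simp
  | succ n ih =>
    rw [iteratedDeriv_succ']
    have : deriv (fun x => h • ∑ j ∈ Finset.range s, (P j).eval x • d j) =
        fun x => h • ∑ j ∈ Finset.range s, (Polynomial.derivative (P j)).eval x • d j := by
      funext x
      exact (HasDerivAt.fun_const_smul h (HasDerivAt.fun_sum fun j _ =>
        ((P j).hasDerivAt x).smul_const (d j))).deriv
    rw [this, ih]
    simp only [Function.iterate_succ_apply]

/-- Data of a family of perturbed collocation steps for `y' = f(y)`: `V h` is the rescaled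
polynomial, `γ h j` its discrete Legendre coefficients and `η h j` the factors multiplying them,
which are `1 + O(h^{2(s-1-j)+e})`. -/
structure IsStepFamily {k : ℕ} (f : E → E) (y₀ : E) (s : ℕ) (c b : Fin k → ℝ)
    (η : ℝ → ℕ → ℝ) (γ : ℝ → ℕ → E) (V : ℝ → ℝ → E) (e : ℕ) : Prop where
  bdd : SmoothBdd f
  gauss : IsGaussLegendre k c b
  le : s ≤ k
  eq : ∀ h, V h = stepPoly s y₀ h fun j => η h j • γ h j
  coeff : ∀ᶠ h in 𝓝[>] (0 : ℝ), ∀ j < s,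
    γ h j = ∑ l, (b l * (legendre j).eval (c l)) • f (V h (c l))
  eta : ∀ j < s, (fun h => 1 - η h j) =O[𝓝[>] (0 : ℝ)] fun h => h ^ (2 * (s - 1 - j) + e)

namespace IsStepFamily

variable {k s e : ℕ} {f : E → E} {y₀ : E} {c b : Fin k → ℝ} {η : ℝ → ℕ → ℝ} {γ : ℝ → ℕ → E}
  {V : ℝ → ℝ → E}

lemma eta_isBigO_one (S : IsStepFamily f y₀ s c b η γ V e) {j : ℕ} (hj : j < s) :
    (fun h => η h j) =O[𝓝[>] (0 : ℝ)] fun h => h ^ 0 := by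
  have h1 := (isBigO_refl (fun h : ℝ => h ^ 0) (𝓝[>] (0 : ℝ))).sub
    ((S.eta j hj).trans (isBigO_pow_of_le (Nat.zero_le _)))
  exact h1.congr_left fun h => by simp

lemma hasDerivAt (S : IsStepFamily f y₀ s c b η γ V e) (h x : ℝ) :
    HasDerivAt (V h)
      (h • ∑ j ∈ Finset.range s, (legendre j).eval x • η h j • γ h j) x := by
  rw [S.eq h]; exact hasDerivAt_stepPoly _ _ _ _ _

lemma coeff_isBigO_of_scaledTo (S : IsStepFamily f y₀ s c b η γ V e) {N : ℕ} (hV : ScaledTo N V)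
    {j : ℕ} (hj : j < s) : (fun h => γ h j) =O[𝓝[>] (0 : ℝ)] fun h => h ^ min N j := by
  have hle := S.le
  refine (((hV.comp S.bdd).mono (min_le_left N j)).gauss_legendre S.gauss
    (by omega) (min_le_right N j)).congr' ?_ EventuallyEq.rfl
  filter_upwards [S.coeff] with h hh
  exact (hh j hj).symm

/-- Bootstrap: scaling up to order `N` makes `γ h j` of order `min N j`, and the factor `h` in `V'`
then gives scaling up to order `N + 1`. The start needs only that `f` is bounded. -/
lemma scaledTo (S : IsStepFamily f y₀ s c b η γ V e) (N : ℕ) : ScaledTo N V := by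
  have hs : ∀ h, ContDiff ℝ ∞ fun x => h • ∑ j ∈ Finset.range s,
      (legendre j).eval x • η h j • γ h j := fun h =>
    (ContDiff.sum fun j _ => ((legendre j).contDiff_aeval (𝕜 := ℝ) ∞ |>.smul
      contDiff_const)).const_smul h
  have hγ0 : ∀ j < s, (fun h => γ h j) =O[𝓝[>] (0 : ℝ)] fun h => h ^ 0 := by
    intro j hj
    obtain ⟨C, -, hC⟩ := S.bdd.exists_norm_le
    have h1 : (fun h => ∑ l, (b l * (legendre j).eval (c l)) • f (V h (c l)))
        =O[𝓝[>] (0 : ℝ)] fun h => h ^ 0 := by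
      refine IsBigO.fun_sum fun l _ => IsBigO.const_smul_left (IsBigO.of_bound C ?_) _
      exact Eventually.of_forall fun h => by simpa using hC _
    refine h1.congr' ?_ EventuallyEq.rfl
    filter_upwards [S.coeff] with h hh
    exact (hh j hj).symm
  have hV0 : UnifO V 0 := by
    have h1 := (unifO_stepPoly_sub s y₀ fun j hj =>
      (by simpa using (S.eta_isBigO_one hj).smul (hγ0 j hj) :
        (fun h => η h j • γ h j) =O[𝓝[>] (0 : ℝ)] fun h => h ^ 0)).mono (Nat.zero_le 1)
    refine (IsBigO.add (UnifO.of_continuous (continuous_const (y := y₀))) h1).congr_left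
      fun z => ?_
    rw [S.eq, add_sub_cancel]
  induction N with
  | zero => exact .of_deriv hV0 S.hasDerivAt hs (by simp)
  | succ N ih =>
    refine .of_deriv hV0 S.hasDerivAt hs fun n hn => ?_
    have h1 : UnifO (fun h x => ∑ j ∈ Finset.range s,
        (Polynomial.derivative^[n] (legendre j)).eval x • η h j • γ h j) n := by
      refine IsBigO.fun_sum fun j hj => ?_
      have hj := Finset.mem_range.1 hj
      -- Terms of degree `j < n` disappear under `n` derivatives; the others have coefficients of
      -- order at least `n`.
      rcases lt_or_ge j n with hjn | hjn
      · refine (isBigO_zero _ _).congr_left fun z => ?_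
        rw [Polynomial.iterate_derivative_eq_zero (by rwa [natDegree_legendre]),
          Polynomial.eval_zero, zero_smul]
      · have := (UnifO.of_continuous (Polynomial.derivative^[n] (legendre j)).continuous).smul
          ((UnifO.of_step (S.eta_isBigO_one hj)).smul
            (UnifO.of_step (S.coeff_isBigO_of_scaledTo ih hj)))
        exact UnifO.mono this (by omega)
    refine h1.const_smul_step.congr_left fun z => ?_
    beta_reduce
    rw [iteratedDeriv_smul_sum_eval]

lemma coeff_isBigO (S : IsStepFamily f y₀ s c b η γ V e) {j : ℕ} (hj : j < s) :
    (fun h => γ h j) =O[𝓝[>] (0 : ℝ)] fun h => h ^ j := by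
  simpa using S.coeff_isBigO_of_scaledTo (S.scaledTo j) hj

lemma sub_coeff_isBigO (S : IsStepFamily f y₀ s c b η γ V e) {j : ℕ} (hj : j < s) :
    (fun h => γ h j - ∫ x in (0 : ℝ)..1, (legendre j).eval x • f (V h x))
      =O[𝓝[>] (0 : ℝ)] fun h => h ^ (2 * s - j) := by
  have hle := S.le
  refine (((S.scaledTo (2 * s - j)).comp S.bdd).gauss_sub_integral (j := j) S.gauss
    (by omega)).congr' ?_ EventuallyEq.rfl
  filter_upwards [S.coeff] with h hh
  rw [hh j hj]

/-- Two sources: `1 - η` times a coefficient of order `h^j`, and the quadrature error `h^(2s-j)`.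
For `e = 2` they balance. -/
lemma defect_isBigO (S : IsStepFamily f y₀ s c b η γ V e) (he : e ≤ 2) {j : ℕ} (hj : j < s) :
    (fun h => (∫ x in (0 : ℝ)..1, (legendre j).eval x • f (V h x)) - η h j • γ h j)
      =O[𝓝[>] (0 : ℝ)] fun h => h ^ (2 * s - 2 - j + e) := by
  have h1 := (S.eta j hj).smul (S.coeff_isBigO hj)
  simp only [smul_eq_mul, ← pow_add] at h1
  refine ((h1.trans (isBigO_pow_of_le ?_)).sub
    ((S.sub_coeff_isBigO hj).trans (isBigO_pow_of_le ?_))).congr_left fun h => ?_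
  · omega
  · omega
  · module

/-- The residual `f(V) - V'/h`. -/
noncomputable def residual (f : E → E) (s : ℕ) (η : ℝ → ℕ → ℝ) (γ : ℝ → ℕ → E) (V : ℝ → ℝ → E)
    (h x : ℝ) : E :=
  f (V h x) - ∑ j ∈ Finset.range s, (legendre j).eval x • η h j • γ h j

lemma continuous_residual (S : IsStepFamily f y₀ s c b η γ V e) (h : ℝ) :
    Continuous (residual f s η γ V h) := by
  unfold residual
  exact (((S.scaledTo 0).comp S.bdd).smooth h).continuous.sub
    (continuous_finsetSum _ fun j _ => (legendre j).continuous.smul continuous_const)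

lemma residual_eq (f : E → E) (s : ℕ) (η : ℝ → ℕ → ℝ) (γ : ℝ → ℕ → E) (V : ℝ → ℝ → E) (h x : ℝ) :
    residual f s η γ V h x = (f (V h x) - legendreProj s (fun x => f (V h x)) x) +
      ∑ j ∈ Finset.range s, (legendre j).eval x •
        ((∫ x in (0 : ℝ)..1, (legendre j).eval x • f (V h x)) - η h j • γ h j) := by
  simp only [residual, legendreProj, smul_sub, Finset.sum_sub_distrib]
  abel

/-- The order `s - 1` is set by the defect with `j = s - 1` in the worst case `e = 0`. -/
lemma unifO_residual (S : IsStepFamily f y₀ s c b η γ V e) (he : e ≤ 2) :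
    UnifO (residual f s η γ V) (s - 1) := by
  refine (IsBigO.add (((S.scaledTo s).comp S.bdd).sub_legendreProj.mono (Nat.sub_le s 1))
    (IsBigO.fun_sum (A := fun j (z : ℝ × ℝ) => (legendre j).eval z.2 •
      ((∫ x in (0 : ℝ)..1, (legendre j).eval x • f (V z.1 x)) - η z.1 j • γ z.1 j))
      (s := Finset.range s) fun j hj => ?_)).congr_left fun z => (residual_eq _ _ _ _ _ _ _).symm
  have hj := Finset.mem_range.1 hj
  exact ((UnifO.of_continuous (legendre j).continuous).smul
    (UnifO.of_step (S.defect_isBigO he hj))).mono (by omega)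

lemma integral_residual_isBigO (S : IsStepFamily f y₀ s c b η γ V 2) {Z : ℝ → ℝ → E →L[ℝ] E}
    (hZ : ScaledTo s Z) : (fun h => ∫ x in (0 : ℝ)..1, Z h x (residual f s η γ V h x))
      =O[𝓝[>] (0 : ℝ)] fun h => h ^ (2 * s) := by
  have h1 := hZ.integral_bilin_sub_legendreProj (ContinuousLinearMap.id ℝ (E →L[ℝ] E))
    ((S.scaledTo s).comp S.bdd)
  have h2 : (fun h => ∑ j ∈ Finset.range s,
      (∫ x in (0 : ℝ)..1, (legendre j).eval x • Z h x)
        ((∫ x in (0 : ℝ)..1, (legendre j).eval x • f (V h x)) - η h j • γ h j))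
      =O[𝓝[>] (0 : ℝ)] fun h => h ^ (2 * s) := by
    refine IsBigO.fun_sum fun j hj => ?_
    have hj := Finset.mem_range.1 hj
    -- The coefficient of `Z`, of order `h^j`, exactly compensates the defect of order `h^(2s-j)`.
    have h3 := (UnifO.of_step ((hZ.mono hj.le).integral_legendre le_rfl)).bilin
      (ContinuousLinearMap.id ℝ (E →L[ℝ] E)) (UnifO.of_step (S.defect_isBigO le_rfl hj))
    exact (h3.mono (by omega)).at (x := 0) (by simp)
  refine (h1.add h2).congr_left fun h => ?_
  have hZc := (hZ.smooth h).continuous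
  have hfc := (((S.scaledTo 0).comp S.bdd).smooth h).continuous
  have hpc := continuous_legendreProj s (fun x => f (V h x))
  simp only [residual_eq, map_add, map_sum, map_smul, ContinuousLinearMap.id_apply]
  rw [intervalIntegral.integral_add, intervalIntegral.integral_finsetSum]
  · congr 1
    refine Finset.sum_congr rfl fun j _ => ?_
    rw [ContinuousLinearMap.intervalIntegral_apply]
    · rfl
    · exact ((legendre j).continuous.smul hZc).intervalIntegrable _ _
  · intro j _
    apply Continuous.intervalIntegrable
    exact (legendre j).continuous.smul (hZc.clm_apply continuous_const)
  · apply Continuous.intervalIntegrable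
    exact hZc.clm_apply (hfc.sub hpc)
  · apply Continuous.intervalIntegrable
    exact continuous_finsetSum _ fun j _ =>
      (legendre j).continuous.smul (hZc.clm_apply continuous_const)

end IsStepFamily

end Step

end ELIM

/-! ### Comparison with the exact solution: Grönwall and superconvergence. -/

namespace ELIM

set_option linter.unusedSectionVars false

variable {E : Type*} [NormedAddCommGroup E] [NormedSpace ℝ E] [CompleteSpace E]

/-- `w h` solves the rescaled initial value problem `w' = h f(w)`, `w(0) = y₀` on `[0,1]`. -/
def IsRescaledSolution (f : E → E) (y₀ : E) (w : ℝ → ℝ → E) : Prop :=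
  ∀ᶠ h in 𝓝[>] (0 : ℝ), w h 0 = y₀ ∧
    ∀ x ∈ Icc (0 : ℝ) 1, HasDerivWithinAt (w h) (h • f (w h x)) (Icc 0 1) x

lemma IsRescaledSolution.continuousOn {f : E → E} {y₀ : E} {w : ℝ → ℝ → E}
    (hw : IsRescaledSolution f y₀ w) :
    ∀ᶠ h in 𝓝[>] (0 : ℝ), ContinuousOn (w h) (Icc 0 1) := by
  filter_upwards [hw] with h hh x hx
  exact (hh.2 x hx).continuousWithinAt

namespace IsStepFamily

variable {k s e : ℕ} {f : E → E} {y₀ : E} {c b : Fin k → ℝ} {η : ℝ → ℕ → ℝ} {γ : ℝ → ℕ → E}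
  {V w : ℝ → ℝ → E}

lemma hasDerivAt_residual (S : IsStepFamily f y₀ s c b η γ V e) (h x : ℝ) :
    HasDerivAt (V h) (h • (f (V h x) - residual f s η γ V h x)) x := by
  simpa only [residual, sub_sub_cancel] using S.hasDerivAt h x

lemma apply_zero (S : IsStepFamily f y₀ s c b η γ V e) (h : ℝ) : V h 0 = y₀ := by
  rw [S.eq, stepPoly_zero]

/-- The global error over one step, by Grönwall's inequality. -/
lemma unifO_sub (S : IsStepFamily f y₀ s c b η γ V e) (he : e ≤ 2) (hs : 0 < s)
    (hw : IsRescaledSolution f y₀ w) : UnifO (fun h x => V h x - w h x) s := by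
  obtain ⟨C, hC0, hC⟩ := unifO_iff.1 (S.unifO_residual he)
  obtain ⟨M, hM0, hM⟩ := S.bdd.exists_lipschitz
  refine unifO_iff.2 ⟨C * Real.exp 1, by positivity, ?_⟩
  have hsmall : ∀ᶠ h in 𝓝[>] (0 : ℝ), h * M ≤ 1 := by
    have : Tendsto (fun h : ℝ => h * M) (𝓝[>] 0) (𝓝 (0 * M)) :=
      (tendsto_nhdsWithin_of_tendsto_nhds tendsto_id).mul_const M
    rw [zero_mul] at this
    exact (this.eventually (gt_mem_nhds zero_lt_one)).mono fun _ h => h.le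
  filter_upwards [hC, hw, hsmall, self_mem_nhdsWithin] with h hr hwh hhM h0 x hx
  have h0 : (0 : ℝ) < h := h0
  have hd : ∀ x ∈ Icc (0 : ℝ) 1, HasDerivWithinAt (fun x => V h x - w h x)
      (h • (f (V h x) - residual f s η γ V h x) - h • f (w h x)) (Icc 0 1) x := fun x hx =>
    (S.hasDerivAt_residual h x).hasDerivWithinAt.sub (hwh.2 x hx)
  -- The constant `K = 1` is allowed because `h M ≤ 1`; the factor `h` before the residual raises
  -- `h^(s-1)` to `h^s`.
  have hg := norm_le_gronwallBound_of_norm_deriv_right_le (δ := 0) (K := 1) (ε := C * h ^ s)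
    (fun x hx => (hd x hx).continuousWithinAt)
    (fun x hx => (hd x (Ico_subset_Icc_self hx)).mono_of_mem_nhdsWithin
      (Icc_mem_nhdsGE_of_mem hx))
    (by rw [S.apply_zero, hwh.1, sub_self, norm_zero]) (fun x hx => ?_) x hx
  · refine hg.trans ?_
    rw [gronwallBound_of_K_ne_0 one_ne_zero]
    beta_reduce
    rw [zero_mul, zero_add, div_one, one_mul, sub_zero,
      mul_right_comm]
    have : Real.exp x - 1 ≤ Real.exp 1 := by
      have := Real.exp_le_exp.2 hx.2
      linarith
    gcongr
  · have hx := Ico_subset_Icc_self hx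
    rw [show h • (f (V h x) - residual f s η γ V h x) - h • f (w h x) =
      h • (f (V h x) - f (w h x)) - h • residual f s η γ V h x by module]
    refine (norm_sub_le _ _).trans (add_le_add ?_ ?_)
    · rw [norm_smul, Real.norm_of_nonneg h0.le]
      calc h * ‖f (V h x) - f (w h x)‖ ≤ h * (M * ‖V h x - w h x‖) := by gcongr; exact hM _ _
        _ = (h * M) * ‖V h x - w h x‖ := by ring
        _ ≤ 1 * ‖V h x - w h x‖ := by gcongr
    · rw [norm_smul, Real.norm_of_nonneg h0.le]
      calc h * ‖residual f s η γ V h x‖ ≤ h * (C * h ^ (s - 1)) := by gcongr; exact hr x hx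
        _ = C * (h * h ^ (s - 1)) := by ring
        _ = C * h ^ s := by rw [← pow_succ', Nat.sub_add_cancel hs]

/-- Superconvergence at the end of the step. -/
lemma sub_isBigO (S : IsStepFamily f y₀ s c b η γ V 2) (hs : 0 < s)
    (hw : IsRescaledSolution f y₀ w) :
    (fun h => V h 1 - w h 1) =O[𝓝[>] (0 : ℝ)] fun h => h ^ (2 * s + 1) := by
  have hA : ScaledTo s (fun h x => fderiv ℝ f (V h x)) := (S.scaledTo s).comp S.bdd.fderiv
  obtain ⟨Z, R, hZ, hZ1, hR, hZd⟩ := exists_approx_adjoint hA (s + 1)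
  have he := S.unifO_sub le_rfl hs hw
  -- Remainder of the linearization about `V`, quadratic in an error of order `h^s`.
  set ρ : ℝ → ℝ → E := fun h x =>
    f (V h x) - f (w h x) - fderiv ℝ f (V h x) (V h x - w h x) with hρd
  have hρ : UnifO ρ (2 * s) := by
    obtain ⟨C, -, hC⟩ := S.bdd.exists_taylor_two
    have h1 := ((he.norm_left.mul he.norm_left).const_mul_left C)
    simp only [← pow_add, ← two_mul] at h1
    refine IsBigO.trans (IsBigO.of_norm_le fun z => ?_) h1
    have h2 := hC (V z.1 z.2) (w z.1 z.2)
    rw [← norm_neg, norm_sub_rev (w z.1 z.2), sq] at h2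
    have h3 : ρ z.1 z.2 = -(f (w z.1 z.2) - f (V z.1 z.2) -
        fderiv ℝ f (V z.1 z.2) (w z.1 z.2 - V z.1 z.2)) := by
      simp only [hρd, map_sub]
      abel
    rwa [h3]
  have hbound : UnifO (fun h x => R h x (V h x - w h x) + h • Z h x (ρ h x)) (2 * s + 1) := by
    have h1 := hR.bilin (ContinuousLinearMap.id ℝ (E →L[ℝ] E)) he
    have h2 := (hZ.unifO.bilin (ContinuousLinearMap.id ℝ (E →L[ℝ] E)) hρ).const_smul_step
    exact IsBigO.add (UnifO.mono h1 (by omega)) (UnifO.mono h2 (by omega))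
  obtain ⟨C, hC0, hC⟩ := unifO_iff.1 hbound
  have hg : (fun h => (V h 1 - w h 1) + h • ∫ x in (0 : ℝ)..1, Z h x (residual f s η γ V h x))
      =O[𝓝[>] (0 : ℝ)] fun h => h ^ (2 * s + 1) := by
    refine IsBigO.of_bound C ?_
    filter_upwards [hC, hw, self_mem_nhdsWithin] with h hb hwh h0
    have h0 : (0 : ℝ) < h := h0
    have hcont : Continuous fun x => Z h x (residual f s η γ V h x) :=
      (hZ.smooth h).continuous.clm_apply (S.continuous_residual h)
    -- The adjoint equation cancels the linear part of `f(V) - f(w)`, and the added integral cancels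
    -- the residual. What is left is `O(h^(2s+1))`: `R` is `O(h^(s+1))` against an error `O(h^s)`,
    -- and `h ρ` is small enough by itself.
    have hd : ∀ x ∈ Icc (0 : ℝ) 1, HasDerivWithinAt (fun x => Z h x (V h x - w h x) +
        h • ∫ t in (0 : ℝ)..x, Z h t (residual f s η γ V h t))
        (R h x (V h x - w h x) + h • Z h x (ρ h x)) (Icc 0 1) x := by
      intro x hx
      have h1 := (hZd h x).hasDerivWithinAt (s := Icc 0 1) |>.clm_apply
        ((S.hasDerivAt_residual h x).hasDerivWithinAt.sub (hwh.2 x hx))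
      have h2 := ((intervalIntegral.integral_hasDerivAt_right (hcont.intervalIntegrable 0 x)
        (hcont.stronglyMeasurableAtFilter _ _) hcont.continuousAt).const_smul
          h).hasDerivWithinAt (s := Icc 0 1)
      refine (h1.add h2).congr_deriv ?_
      simp only [hρd, Pi.sub_apply, _root_.sub_apply, _root_.smul_apply, map_sub, map_smul,
        ContinuousLinearMap.comp_apply, smul_sub]
      abel
    have hmv := norm_image_sub_le_of_norm_deriv_le_segment' hd
      (fun x hx => hb x (Ico_subset_Icc_self hx)) 1 (right_mem_Icc.2 zero_le_one)
    rw [hZ1, S.apply_zero, hwh.1] at hmv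
    simpa [abs_of_pos h0] using hmv
  have hi := (isBigO_refl (fun h : ℝ => h) (𝓝[>] (0 : ℝ))).smul (S.integral_residual_isBigO hZ)
  simp only [smul_eq_mul, ← pow_succ'] at hi
  exact (hg.sub hi).congr_left fun h => by abel

end IsStepFamily

/-! ### Invariants and the size of the system for the multipliers. -/

section Invariants

variable {F : Type*} [NormedAddCommGroup F] [InnerProductSpace ℝ F] [CompleteSpace F]

namespace IsStepFamily

variable {k r s e : ℕ} {f g : F → F} {y₀ : F} {c b : Fin k → ℝ} {c' b' : Fin r → ℝ}
  {η : ℝ → ℕ → ℝ} {γ : ℝ → ℕ → F} {V w : ℝ → ℝ → F}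

lemma isBigO_inner {l : Filter ℝ} {p q : ℝ → F} {m n : ℕ} (hp : p =O[l] fun h => h ^ m)
    (hq : q =O[l] fun h => h ^ n) : (fun h => inner ℝ (p h) (q h)) =O[l] fun h => h ^ (m + n) := by
  have h1 := hp.norm_left.mul hq.norm_left
  simp only [← pow_add] at h1
  exact IsBigO.trans (IsBigO.of_norm_le fun h => norm_inner_le_norm _ _) h1

/-- The defect of the discrete Legendre coefficients in the conservation of an invariant. -/
lemma sum_inner_isBigO (S : IsStepFamily f y₀ s c b η γ V e) (hg : SmoothBdd g)
    (hcb' : IsGaussLegendre r c' b') (hr : s ≤ r) (horth : ∀ x, inner ℝ (g x) (f x) = 0) :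
    (fun h => ∑ j ∈ Finset.range s,
      inner ℝ (∑ l, (b' l * (legendre j).eval (c' l)) • g (V h (c' l))) (γ h j))
      =O[𝓝[>] (0 : ℝ)] fun h => h ^ (2 * s) := by
  have hgV := fun N => (S.scaledTo N).comp hg
  have h1 := (hgV s).integral_bilin_sub_legendreProj (innerSL ℝ) ((S.scaledTo s).comp S.bdd)
  -- Replacing discrete coefficients by exact ones costs `h^(2s-j) * h^j` in either factor.
  have h2 : (fun h => ∑ j ∈ Finset.range s,
      (inner ℝ (∑ l, (b' l * (legendre j).eval (c' l)) • g (V h (c' l))) (γ h j) -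
        inner ℝ (∫ x in (0 : ℝ)..1, (legendre j).eval x • g (V h x))
          (∫ x in (0 : ℝ)..1, (legendre j).eval x • f (V h x))))
      =O[𝓝[>] (0 : ℝ)] fun h => h ^ (2 * s) := by
    refine IsBigO.fun_sum fun j hj => ?_
    have hj := Finset.mem_range.1 hj
    have h3 := isBigO_inner ((hgV (2 * s - j)).gauss_sub_integral (j := j) hcb' (by omega))
      (S.coeff_isBigO hj)
    have h4 := isBigO_inner ((hgV j).integral_legendre le_rfl) (S.sub_coeff_isBigO hj)
    rw [show 2 * s - j + j = 2 * s by omega] at h3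
    rw [show j + (2 * s - j) = 2 * s by omega] at h4
    refine (h3.add h4).congr_left fun h => ?_
    rw [inner_sub_left, inner_sub_right]
    ring
  refine (h2.sub h1).congr_left fun h => ?_
  have hgc := ((hgV 0).smooth h).continuous
  have hfc := (((S.scaledTo 0).comp S.bdd).smooth h).continuous
  have hpc := continuous_legendreProj s (fun x => f (V h x))
  rw [Finset.sum_sub_distrib, sub_sub, sub_eq_self]
  -- Orthogonality of `g` and `f` turns the integral against the projection into minus the integral
  -- against its remainder, bounded in `h1`.
  have hneg : ∀ x, innerSL ℝ (g (V h x)) (f (V h x) - legendreProj s (fun x => f (V h x)) x) =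
      -inner ℝ (g (V h x)) (legendreProj s (fun x => f (V h x)) x) := fun x => by
    rw [innerSL_apply_apply, inner_sub_right, horth, zero_sub]
  simp only [hneg]
  rw [intervalIntegral.integral_neg, add_neg_eq_zero]
  simp only [legendreProj, inner_sum, inner_smul_right]
  rw [intervalIntegral.integral_finsetSum]
  · refine Finset.sum_congr rfl fun j _ => ?_
    set v := ∫ x in (0 : ℝ)..1, (legendre j).eval x • f (V h x)
    rw [real_inner_comm, ← innerSL_apply_apply ℝ, ← ContinuousLinearMap.intervalIntegral_comp_comm]
    · simp only [map_smul, innerSL_apply_apply, smul_eq_mul, real_inner_comm v]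
    · exact ((legendre j).continuous.smul hgc).intervalIntegrable _ _
  · intro j _
    apply Continuous.intervalIntegrable
    exact (legendre j).continuous.mul (hgc.inner continuous_const)

lemma integral_sub_isBigO {p : F → F} (S : IsStepFamily f y₀ s c b η γ V e) (hp : SmoothBdd p)
    (hw : IsRescaledSolution f y₀ w) (he : UnifO (fun h x => V h x - w h x) s) (j : ℕ) :
    (fun h => (∫ x in (0 : ℝ)..1, (legendre j).eval x • p (V h x)) -
      ∫ x in (0 : ℝ)..1, (legendre j).eval x • p (w h x)) =O[𝓝[>] (0 : ℝ)] fun h => h ^ s := by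
  obtain ⟨M, -, hM⟩ := hp.exists_lipschitz
  have h1 : UnifO (fun h x => p (V h x) - p (w h x)) s :=
    IsBigO.trans (IsBigO.of_norm_le fun z => hM _ _) (he.norm_left.const_mul_left M)
  refine (unifO_integral_eval_smul (legendre j) h1).congr' ?_ EventuallyEq.rfl
  filter_upwards [hw.continuousOn] with h hwc
  simp only [smul_sub]
  refine intervalIntegral.integral_sub ?_ ?_
  · exact ((legendre j).continuous.smul
      (((S.scaledTo 0).comp hp).smooth h).continuous).intervalIntegrable _ _
  · apply ContinuousOn.intervalIntegrable
    rw [uIcc_of_le zero_le_one]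
    exact (legendre j).continuous.continuousOn.smul (hp.smooth.continuous.comp_continuousOn hwc)

lemma inner_gauss_isBigO (S : IsStepFamily f y₀ s c b η γ V e) (hg : SmoothBdd g)
    (hcb' : IsGaussLegendre r c' b') (hr : s ≤ r) {j : ℕ} (hj : j < s) :
    (fun h => inner ℝ (∑ l, (b' l * (legendre j).eval (c' l)) • g (V h (c' l))) (γ h j))
      =O[𝓝[>] (0 : ℝ)] fun h => h ^ (j + j) :=
  isBigO_inner (((S.scaledTo j).comp hg).gauss_legendre hcb' (by omega) le_rfl)
    (S.coeff_isBigO hj)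

/-- Comparison of the discrete matrix entries with those of the exact solution. -/
lemma inner_gauss_sub_isBigO (S : IsStepFamily f y₀ s c b η γ V e) (he : e ≤ 2)
    (hg : SmoothBdd g) (hcb' : IsGaussLegendre r c' b') (hr : s ≤ r)
    (hw : IsRescaledSolution f y₀ w) {j : ℕ} (hj : j < s) :
    (fun h => inner ℝ (∑ l, (b' l * (legendre j).eval (c' l)) • g (V h (c' l))) (γ h j) -
      inner ℝ (∫ x in (0 : ℝ)..1, (legendre j).eval x • g (w h x))
        (∫ x in (0 : ℝ)..1, (legendre j).eval x • f (w h x)))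
      =O[𝓝[>] (0 : ℝ)] fun h => h ^ (j + j + 1) := by
  have hsub := S.unifO_sub he (by omega) hw
  have h1 : (fun h => (∑ l, (b' l * (legendre j).eval (c' l)) • g (V h (c' l))) -
      ∫ x in (0 : ℝ)..1, (legendre j).eval x • g (w h x))
      =O[𝓝[>] (0 : ℝ)] fun h => h ^ (j + 1) := by
    refine ((((S.scaledTo (j + 1)).comp hg).gauss_sub_integral (j := j) hcb' (by omega)).add
      ((S.integral_sub_isBigO hg hw hsub j).trans (isBigO_pow_of_le hj))).congr_left fun h => ?_
    abel
  have h2 : (fun h => γ h j - ∫ x in (0 : ℝ)..1, (legendre j).eval x • f (w h x))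
      =O[𝓝[>] (0 : ℝ)] fun h => h ^ (j + 1) := by
    refine (((S.sub_coeff_isBigO hj).trans (isBigO_pow_of_le (by omega))).add
      ((S.integral_sub_isBigO S.bdd hw hsub j).trans (isBigO_pow_of_le hj))).congr_left
        fun h => ?_
    abel
  have h3 : (fun h => ∑ l, (b' l * (legendre j).eval (c' l)) • g (V h (c' l)))
      =O[𝓝[>] (0 : ℝ)] fun h => h ^ j :=
    ((S.scaledTo j).comp hg).gauss_legendre hcb' (by omega) le_rfl
  have h4 : (fun h => ∫ x in (0 : ℝ)..1, (legendre j).eval x • f (w h x))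
      =O[𝓝[>] (0 : ℝ)] fun h => h ^ j :=
    ((S.coeff_isBigO hj).sub (h2.trans (isBigO_pow_of_le (Nat.le_succ j)))).congr_left
      fun h => by abel
  have h5 := isBigO_inner h1 h4
  have h6 := isBigO_inner h3 h2
  rw [show j + 1 + j = j + j + 1 by omega] at h5
  refine (h5.add h6).congr_left fun h => ?_
  rw [inner_sub_left, inner_sub_right]
  ring

end IsStepFamily

end Invariants

end ELIM

/-! ### Localization near the initial value and conclusion. -/

namespace ELIM

lemma contDiffOn_gradient {E : Type*} [NormedAddCommGroup E] [InnerProductSpace ℝ E]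
    [CompleteSpace E] {F : E → ℝ} {Ω : Set E} (hΩ : IsOpen Ω) (hF : ContDiffOn ℝ ∞ F Ω) :
    ContDiffOn ℝ ∞ (gradient F) Ω :=
  (InnerProductSpace.toDual ℝ E).symm.contDiff.comp_contDiffOn
    (hF.fderiv_of_isOpen hΩ (by exact_mod_cast le_top))

lemma contDiffOn_hamField {m : ℕ} {H : Phase m → ℝ} {Ω : Set (Phase m)} (hΩ : IsOpen Ω)
    (hH : ContDiffOn ℝ ∞ H Ω) : ContDiffOn ℝ ∞ (hamField H) Ω :=
  (Matrix.toEuclideanCLM (𝕜 := ℝ) (J m)).contDiff.comp_contDiffOn (contDiffOn_gradient hΩ hH)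

lemma smoothBdd_bump_smul {E G : Type*} [NormedAddCommGroup E] [InnerProductSpace ℝ E]
    [FiniteDimensional ℝ E] [NormedAddCommGroup G] [NormedSpace ℝ G] {y₀ : E}
    (χ : ContDiffBump y₀) {F : E → G} {Ω : Set E} (hΩ : IsOpen Ω) (hF : ContDiffOn ℝ ∞ F Ω)
    (hχ : Metric.closedBall y₀ χ.rOut ⊆ Ω) : SmoothBdd (fun x => χ x • F x) := by
  refine .of_hasCompactSupport (contDiff_iff_contDiffAt.2 fun x => ?_)
    χ.hasCompactSupport.smul_right
  by_cases hx : x ∈ Ω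
  · exact χ.contDiff.contDiffAt.smul (hF.contDiffAt (hΩ.mem_nhds hx))
  · have hx' : x ∉ tsupport χ := fun h => hx (hχ (χ.tsupport_eq ▸ h))
    have h0 : (fun x => χ x • F x) =ᶠ[𝓝 x] fun _ => 0 := by
      filter_upwards [notMem_tsupport_iff_eventuallyEq.1 hx'] with z hz
      rw [hz, Pi.zero_apply, zero_smul]
    exact contDiffAt_const.congr_of_eventuallyEq h0

lemma one_sub_etaHat_isBigO {ν s e : ℕ} {α : ℝ → Fin ν → ℝ}
    (hα : ∀ i, (fun h => α h i) =O[𝓝[>] (0 : ℝ)] fun h => h ^ e) (j : ℕ) :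
    (fun h => 1 - etaHat s h (α h) j) =O[𝓝[>] (0 : ℝ)] fun h => h ^ (2 * (s - 1 - j) + e) := by
  by_cases hj : s - ν ≤ j ∧ j - (s - ν) < ν
  · have := (isBigO_refl (fun h : ℝ => h ^ (2 * (s - 1 - j))) (𝓝[>] (0 : ℝ))).mul
      (hα ⟨j - (s - ν), hj.2⟩)
    simp only [← pow_add] at this
    refine this.congr_left fun h => ?_
    rw [etaHat, dif_pos hj, sub_sub_cancel]
  · refine (isBigO_zero _ _).congr_left fun h => ?_
    rw [etaHat, dif_neg hj, sub_self]

lemma gammaHat_isBigO {m k : ℕ} {H : Phase m → ℝ} {c b : Fin k → ℝ} {u : ℝ → ℝ → Phase m}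
    {K : Set (Phase m)} (hK : IsCompact K) (hH : ContinuousOn (hamField H) K)
    (hc : ∀ i, c i ∈ Icc (0 : ℝ) 1)
    (huK : ∀ᶠ h in 𝓝[>] (0 : ℝ), ∀ t ∈ Icc 0 h, u h t ∈ K) (j : ℕ) :
    (fun h => gammaHat H c b h (u h) j) =O[𝓝[>] (0 : ℝ)] fun h => h ^ 0 := by
  obtain ⟨C, hC⟩ := hK.exists_bound_of_continuousOn hH
  unfold gammaHat
  refine IsBigO.fun_sum fun l _ => ?_
  have hb : (fun h => hamField H (u h (c l * h))) =O[𝓝[>] (0 : ℝ)] fun h => h ^ 0 := by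
    refine IsBigO.of_bound C ?_
    filter_upwards [huK, self_mem_nhdsWithin] with h hh h0
    have h0 : (0 : ℝ) < h := h0
    rw [pow_zero, norm_one, mul_one]
    exact hC _ (hh _ ⟨mul_nonneg (hc l).1 h0.le, mul_le_of_le_one_left h0.le (hc l).2⟩)
  exact hb.const_smul_left (b l * (legendre j).eval (c l))

lemma UnifO.eventually_mem_closedBall {E : Type*} [NormedAddCommGroup E] [NormedSpace ℝ E]
    {q : ℝ → ℝ → E} {y₀ : E}
    (hq : UnifO (fun h x => q h x - y₀) 1) {ε : ℝ} (hε : 0 < ε) :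
    ∀ᶠ h in 𝓝[>] (0 : ℝ), ∀ x ∈ Icc (0 : ℝ) 1, q h x ∈ Metric.closedBall y₀ ε := by
  obtain ⟨C, -, hC⟩ := unifO_iff.1 hq
  have : Tendsto (fun h : ℝ => C * h ^ 1) (𝓝[>] 0) (𝓝 0) := by
    have : Tendsto (fun h : ℝ => C * h ^ 1) (𝓝 0) (𝓝 (C * 0 ^ 1)) :=
      Continuous.tendsto (by fun_prop) 0
    simpa using tendsto_nhdsWithin_of_tendsto_nhds this
  filter_upwards [hC, this.eventually (gt_mem_nhds hε)] with h h1 h2 x hx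
  rw [mem_closedBall_iff_norm]
  exact (h1 x hx).trans h2.le

lemma eventually_mul_mem_of_continuousWithinAt {E : Type*} [PseudoMetricSpace E] {y : ℝ → E}
    {T : ℝ} (hT : 0 < T) (hy : ContinuousWithinAt y (Icc 0 T) 0) {ε : ℝ} (hε : 0 < ε) :
    ∀ᶠ h in 𝓝[>] (0 : ℝ), ∀ x ∈ Icc (0 : ℝ) 1, x * h ∈ Icc 0 T ∧
      y (x * h) ∈ Metric.closedBall (y 0) ε := by
  obtain ⟨δ, hδ, hball⟩ := Metric.continuousWithinAt_iff.1 hy ε hε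
  filter_upwards [Ioo_mem_nhdsGT (lt_min hδ hT)] with h hh x hx
  have h1 : 0 ≤ x * h := mul_nonneg hx.1 hh.1.le
  have h2 : x * h ≤ h := mul_le_of_le_one_left hh.1.le hx.2
  have h3 : x * h ∈ Icc 0 T := ⟨h1, h2.trans (hh.2.le.trans (min_le_right _ _))⟩
  refine ⟨h3, (hball h3 ?_).le⟩
  rw [Real.dist_eq, sub_zero, abs_of_nonneg h1]
  exact h2.trans_lt (hh.2.trans_le (min_le_left _ _))

end ELIM

theorem mainTheorem1 {m ν r k s : ℕ} (hν : ν < s) (hr : s ≤ r) (hk : s ≤ k)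
    (Ω : Set (ELIM.Phase m)) (hΩ : IsOpen Ω)
    (H : ELIM.Phase m → ℝ) (hH : ContDiffOn ℝ ∞ H Ω)
    (L : ELIM.Phase m → EuclideanSpace ℝ (Fin ν)) (hL : ContDiffOn ℝ ∞ L Ω)
    (hinv : ∀ x ∈ Ω, ∀ i : Fin ν,
      inner ℝ (gradient (fun z => L z i) x) (ELIM.hamField H x) = 0)
    -- the exact solution on `[0,T]`
    (y₀ : ELIM.Phase m) (T : ℝ) (hT : 0 < T) (y : ℝ → ELIM.Phase m) (hy0 : y 0 = y₀)
    (hyΩ : ∀ t ∈ Icc 0 T, y t ∈ Ω)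
    (hy : ∀ t ∈ Icc 0 T, HasDerivWithinAt y (ELIM.hamField H (y t)) (Icc 0 T) t)
    (hΓ : ELIM.GammaNonsingular H L s y)
    -- the two Gauss-Legendre quadratures
    (c b : Fin k → ℝ) (hcb : ELIM.IsGaussLegendre k c b)
    (c' b' : Fin r → ℝ) (hcb' : ELIM.IsGaussLegendre r c' b')
    -- the numerical solutions, for all small step sizes
    (u : ℝ → ℝ → ELIM.Phase m) (α : ℝ → Fin ν → ℝ)
    (hstep : ∀ᶠ h in 𝓝[>] (0 : ℝ), ELIM.IsStep H L s c b c' b' y₀ h (u h) (α h))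
    (K : Set (ELIM.Phase m)) (hK : IsCompact K) (hKΩ : K ⊆ Ω)
    (huK : ∀ᶠ h in 𝓝[>] (0 : ℝ), ∀ t ∈ Icc 0 h, u h t ∈ K)
    (hα : α =O[𝓝[>] 0] (fun _ => (1 : ℝ))) :
    (fun h => u h h - y h) =O[𝓝[>] 0] (fun h => h ^ (2 * s + 1)) := by
  open ELIM in
  have hs : 0 < s := by omega
  have h0T : (0 : ℝ) ∈ Icc 0 T := ⟨le_rfl, hT.le⟩
  have hc : ∀ i, c i ∈ Icc (0 : ℝ) 1 := fun i => Ioo_subset_Icc_self (hcb.mem_Ioo i)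
  have hc' : ∀ i, c' i ∈ Icc (0 : ℝ) 1 := fun i => Ioo_subset_Icc_self (hcb'.mem_Ioo i)
  obtain ⟨ρ, hρ, hρΩ⟩ := Metric.nhds_basis_closedBall.mem_iff.1
    (hΩ.mem_nhds (hy0 ▸ hyΩ 0 h0T : y₀ ∈ Ω))
  -- Cutting off makes the fields globally smooth with bounded derivatives and leaves them unchanged
  -- on the ball of radius `ρ / 2`, where both trajectories stay for small `h`.
  let χ : ContDiffBump y₀ := ⟨ρ / 2, ρ, half_pos hρ, half_lt_self hρ⟩
  have hχ1 : ∀ x ∈ Metric.closedBall y₀ (ρ / 2), χ x = 1 := fun x hx =>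
    χ.one_of_mem_closedBall hx
  have hham := contDiffOn_hamField hΩ hH
  set f : Phase m → Phase m := fun x => χ x • hamField H x with hfdef
  set g : Fin ν → Phase m → Phase m := fun i x => χ x • gradient (fun z => L z i) x with hgdef
  have hf : SmoothBdd f := smoothBdd_bump_smul χ hΩ hham hρΩ
  have hg : ∀ i, SmoothBdd (g i) := fun i => smoothBdd_bump_smul χ hΩ
    (contDiffOn_gradient hΩ
      ((EuclideanSpace.proj (𝕜 := ℝ) i).contDiff.comp_contDiffOn hL)) hρΩ
  have horth : ∀ i x, inner ℝ (g i x) (f x) = 0 := by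
    intro i x
    simp only [hfdef, hgdef, inner_smul_left, inner_smul_right]
    by_cases hx : x ∈ Ω
    · rw [hinv x hx i, mul_zero, mul_zero]
    · have : χ x = 0 := χ.zero_of_le_dist (by
        by_contra! hlt
        exact hx (hρΩ hlt.le))
      simp [this]
  have hfeq : ∀ x ∈ Metric.closedBall y₀ (ρ / 2), f x = hamField H x := fun x hx => by
    simp only [hfdef, hχ1 x hx, one_smul]
  have hgeq : ∀ i, ∀ x ∈ Metric.closedBall y₀ (ρ / 2),
      g i x = gradient (fun z => L z i) x := fun i x hx => by
    simp only [hgdef, hχ1 x hx, one_smul]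
  set η : ℝ → ℕ → ℝ := fun h j => etaHat s h (α h) j with hηdef
  set γ : ℝ → ℕ → Phase m := fun h j => gammaHat H c b h (u h) j with hγdef
  -- `V h` is a polynomial on the whole line for every `h`, whereas `u h` is controlled only on
  -- `[0,h]` and for small `h`.
  set V : ℝ → ℝ → Phase m := fun h => stepPoly s y₀ h fun j => η h j • γ h j with hVdef
  set w : ℝ → ℝ → Phase m := fun h x => y (x * h) with hwdef
  have huV : ∀ᶠ h in 𝓝[>] (0 : ℝ), ∀ x ∈ Icc (0 : ℝ) 1, u h (x * h) = V h x := by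
    filter_upwards [hstep] with h hh x hx
    exact hh.poly x hx
  have hα0 : ∀ i, (fun h => α h i) =O[𝓝[>] (0 : ℝ)] fun h => h ^ 0 := by
    simpa only [pow_zero] using isBigO_pi.1 hα
  -- The coefficients are bounded through the compact set `K`, not the cut-off field, so there is no
  -- circularity.
  have hVball : ∀ᶠ h in 𝓝[>] (0 : ℝ), ∀ x ∈ Icc (0 : ℝ) 1,
      V h x ∈ Metric.closedBall y₀ (ρ / 2) := by
    refine UnifO.eventually_mem_closedBall (unifO_stepPoly_sub s y₀ fun j _ => ?_) (half_pos hρ)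
    have h1 : (fun h => η h j) =O[𝓝[>] (0 : ℝ)] fun h => h ^ 0 :=
      ((isBigO_refl (fun h : ℝ => h ^ 0) (𝓝[>] (0 : ℝ))).sub
        ((one_sub_etaHat_isBigO (s := s) hα0 j).trans
          (isBigO_pow_of_le (Nat.zero_le _)))).congr_left fun h => by simp [hηdef]
    simpa using h1.smul (gammaHat_isBigO (b := b) hK (hham.continuousOn.mono hKΩ) hc huK j)
  have hwball := eventually_mul_mem_of_continuousWithinAt hT (hy 0 h0T).continuousWithinAt
    (half_pos hρ)
  rw [hy0] at hwball
  have hw : IsRescaledSolution f y₀ w := by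
    filter_upwards [hwball] with h hh
    refine ⟨by simp [hwdef, hy0], fun x hx => ?_⟩
    rw [hfeq _ (hh x hx).2]
    have h1 : HasDerivWithinAt (fun x : ℝ => x * h) h (Icc 0 1) x := by
      simpa using (hasDerivWithinAt_id x (Icc (0 : ℝ) 1)).mul_const h
    exact (hy _ (hh x hx).1).scomp x h1 fun z hz => (hh z hz).1
  have hstepFam : ∀ e, (∀ i, (fun h => α h i) =O[𝓝[>] (0 : ℝ)] fun h => h ^ e) →
      IsStepFamily f y₀ s c b η γ V e := fun e he =>
    { bdd := hf
      gauss := hcb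
      le := hk
      eq := fun h => rfl
      coeff := by
        filter_upwards [huV, hVball] with h h1 h2 j _
        simp only [hγdef, gammaHat]
        refine Finset.sum_congr rfl fun l _ => ?_
        rw [h1 _ (hc l), hfeq _ (h2 _ (hc l))]
      eta := fun j _ => one_sub_etaHat_isBigO he j }
  -- First pass, with `α` merely bounded.
  have S0 := hstepFam 0 hα0
  have hφ : ∀ᶠ h in 𝓝[>] (0 : ℝ), ∀ j i, phiHat L c' b' h (u h) j i =
      ∑ l, (b' l * (legendre j).eval (c' l)) • g i (V h (c' l)) := by
    filter_upwards [huV, hVball] with h h1 h2 j i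
    refine Finset.sum_congr rfl fun l _ => ?_
    rw [h1 _ (hc' l), hgeq i _ (h2 _ (hc' l))]
  have hΓw : ∀ᶠ h in 𝓝[>] (0 : ℝ), ∀ j i, phi L h y j i =
      (∫ x in (0 : ℝ)..1, (legendre j).eval x • g i (w h x)) ∧
      gammaBar H h y j = ∫ x in (0 : ℝ)..1, (legendre j).eval x • f (w h x) := by
    filter_upwards [hwball] with h hh j i
    constructor
    · refine intervalIntegral.integral_congr fun x hx => ?_
      rw [uIcc_of_le zero_le_one] at hx
      beta_reduce
      rw [hgeq i _ (hh x hx).2]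
    · refine intervalIntegral.integral_congr fun x hx => ?_
      rw [uIcc_of_le zero_le_one] at hx
      beta_reduce
      rw [hfeq _ (hh x hx).2]
  obtain ⟨κ, hκ, hdet⟩ := hΓ
  set M : ℝ → Matrix (Fin ν) (Fin ν) ℝ := fun h => Matrix.of fun i l =>
    h ^ (2 * (ν - 1 - (l : ℕ))) * inner ℝ (phiHat L c' b' h (u h) (s - ν + l) i)
      (gammaHat H c b h (u h) (s - ν + l)) with hMdef
  have hα2 : ∀ i, (fun h => α h i) =O[𝓝[>] (0 : ℝ)] fun h => h ^ 2 := by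
    refine isBigO_of_mulVec_of_det (M := M) (N := fun h => Gamma H L s h y) (p := 2 * (s - 1))
      hκ (fun i l => ?_) (fun i l => ?_) (by simpa using hdet) fun i => ?_
    · have hl := l.isLt
      have h1 := (isBigO_refl (fun h : ℝ => h ^ (2 * (ν - 1 - (l : ℕ)))) (𝓝[>] (0 : ℝ))).mul
        (S0.inner_gauss_isBigO (hg i) hcb' hr (j := s - ν + l) (by omega))
      simp only [← pow_add] at h1
      -- The power of `h` attached to each column brings all of them to the common order `2s - 2`.
      rw [show 2 * (ν - 1 - (l : ℕ)) + (s - ν + l + (s - ν + l)) = 2 * (s - 1) by omega] at h1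
      refine h1.congr' ?_ EventuallyEq.rfl
      filter_upwards [hφ] with h h2
      simp only [hMdef, Matrix.of_apply, h2]
      rfl
    · have hl := l.isLt
      have h1 := (isBigO_refl (fun h : ℝ => h ^ (2 * (ν - 1 - (l : ℕ)))) (𝓝[>] (0 : ℝ))).mul
        (S0.inner_gauss_sub_isBigO (by norm_num) (hg i) hcb' hr hw (j := s - ν + l) (by omega))
      simp only [← pow_add] at h1
      rw [show 2 * (ν - 1 - (l : ℕ)) + (s - ν + l + (s - ν + l) + 1) = 2 * (s - 1) + 1 by
        omega] at h1
      refine h1.congr' ?_ EventuallyEq.rfl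
      filter_upwards [hφ, hΓw] with h h2 h3
      simp only [hMdef, Gamma, Matrix.of_apply, h2, (h3 (s - ν + l) i).1, (h3 (s - ν + l) i).2,
        mul_sub]
      rfl
    · rw [show 2 * (s - 1) + 2 = 2 * s by omega]
      refine (S0.sum_inner_isBigO (hg i) hcb' hr (horth i)).congr' ?_ EventuallyEq.rfl
      filter_upwards [hφ, hstep] with h h2 h3
      have h4 := h3.invariants i
      simp only [← h2]
      rw [← h4]
      simp only [Matrix.mulVec, dotProduct, hMdef, Matrix.of_apply]
      exact Finset.sum_congr rfl fun l _ => by ring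
  -- Second pass, now with the improved bound on `α`.
  refine ((hstepFam 2 hα2).sub_isBigO hs hw).congr' ?_ EventuallyEq.rfl
  filter_upwards [huV] with h h1
  rw [← h1 1 (right_mem_Icc.2 zero_le_one), one_mul]
  simp only [hwdef, one_mul]
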